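/- For every integer $m\ge 0$ there is a constant $C_m<\infty$, depending only on $m$, such that the following holds. Let $(\Omega,\mathcal F,\mu)$ be a probability space, $n\in\mathbb N$, $1\le p<\infty$, and for every $i=(i_1,\dots,i_m)\in\{1,\dots,n\}^m$ let $f_i\in L^1(\Omega^m)$ be a real- or complex-valued function, where powers of $\Omega$ carry the product measure. Let $\overline\Omega=\bigsqcup_{j=1}^n\Omega$ be the disjoint union of $n$ copies of $\Omega$, with the measure that equals $\mu$ on each copy, and let $\bigsqcup_i f_i$ be the function on $\overline\Omega^m=\bigsqcup_{i\in\{1,\dots,n\}^m}\Omega^m$ equal to $f_i$ on the $i$-th copy of $\Omega^m$. For $J\subset[1,m]=\{1,\dots,m\}$ put $J'=[1,m]\setminus J$ and $$\|a\|_{L^1(\overline\Omega^{J'},L^p(\overline\Omega^{J}))}=\int_{\overline\Omega^{J'}}\Big(\int_{\overline\Omega^{J}}|a|^p\,d\overline x^{(J)}\Big)^{1/p}d\overline x^{(J')}$$ for measurable functions $a$ on $\overline\Omega^m$, where $\overline x^{(J)}$ and $\overline x^{(J')}$ are the variables with index in $J$ and in $J'$. Suppose that $$\int_{\Omega^n}\cdots\int_{\Omega^n}\Big(\sum_{i\in\{1,\dots,n\}^m}\big|f_i\big(x^{(1)}_{i_1},\dots,x^{(m)}_{i_m}\big)\big|^p\Big)^{1/p}dx^{(1)}\cdots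 dx^{(m)}=1 .$$ Then $$1\le\inf\sum_{J\subset[1,m]}\big\|a^{(J)}\big\|_{L^1(\overline\Omega^{J'},L^p(\overline\Omega^{J}))}\le C_m ,$$ where the infimum is taken over all families of functions $a^{(J)}\in L^1(\overline\Omega^{J'},L^p(\overline\Omega^{J}))$, $J\subset[1,m]$, such that $\bigsqcup_i f_i=\sum_{J\subset[1,m]}a^{(J)}$ almost everywhere. Moreover, there is such a family $a^{(J)}=\bigsqcup_i a^{(J)}_i$ with $\sum_{J}\|a^{(J)}\|_{L^1(\overline\Omega^{J'},L^p(\overline\Omega^{J}))}\le C_m$ for which, for every $i$, the supports of the functions $a^{(J)}_i$ for different $J$ are disjoint. -/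

import Mathlib

open MeasureTheory
open scoped ENNReal NNReal

noncomputable section

namespace DecoupledSum

/-- The disjoint union `Ω̄ = ⨆ᵢ Ω` of `n` copies of `Ω`; the pair `(i, x)` is the point `x` of the
`i`-th copy. -/
abbrev Copies (n : ℕ) (Ω : Type*) : Type _ := Fin n × Ω

/-- The measure on the disjoint union of `n` copies of `(Ω, μ)` that restricts to `μ` on each copy:
a set `A` has measure `∑ i, μ {x | (i, x) ∈ A}`. -/
abbrev copiesMeasure (n : ℕ) {Ω : Type*} [MeasurableSpace Ω] (μ : Measure Ω) :
    Measure (Copies n Ω) :=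
  (Measure.count : Measure (Fin n)).prod μ

/-- The function on `Ω̄ᵐ` which is `f i` on the copy of `Ωᵐ` with index `i ∈ [n]ᵐ`. -/
def glue {m n : ℕ} {Ω 𝕜 : Type*} (f : (Fin m → Fin n) → (Fin m → Ω) → 𝕜) :
    (Fin m → Copies n Ω) → 𝕜 :=
  fun z => f (fun k => (z k).1) (fun k => (z k).2)

/-- The restriction of a function on `Ω̄ᵐ` to the copy of `Ωᵐ` with index `i ∈ [n]ᵐ`. -/
def component {m n : ℕ} {Ω 𝕜 : Type*} (a : (Fin m → Copies n Ω) → 𝕜) (i : Fin m → Fin n) :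
    (Fin m → Ω) → 𝕜 :=
  fun x => a (fun k => (i k, x k))

/-- The decoupled mixed integral
`∫ ⋯ ∫ (∑ᵢ |f i (x⁽¹⁾ at i₁, …, x⁽ᵐ⁾ at iₘ)|ᵖ)^(1/p) dx⁽¹⁾ ⋯ dx⁽ᵐ⁾`,
where each `x⁽ᵏ⁾` runs through the product probability space `Ωⁿ`. -/
def decoupledIntegral {m n : ℕ} {Ω 𝕜 : Type*} [MeasurableSpace Ω] [RCLike 𝕜] (μ : Measure Ω)
    (p : ℝ) (f : (Fin m → Fin n) → (Fin m → Ω) → 𝕜) : ℝ≥0∞ :=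
  ∫⁻ x : Fin m → Fin n → Ω,
      (∑ i : Fin m → Fin n, ‖f i (fun k => x k (i k))‖ₑ ^ p) ^ (1 / p)
    ∂(Measure.pi fun _ : Fin m => Measure.pi fun _ : Fin n => μ)

/-- The norm of `L¹(S^{J'}, Lᵖ(S^J))` of a function of `m` variables in `S`, `J'` being the
complement of `J`: the `Lᵖ` norm is taken in the variables with index in `J`, and then the
`L¹` norm in the remaining ones. -/
def mixedNorm {m : ℕ} {S 𝕜 : Type*} [MeasurableSpace S] [RCLike 𝕜] (ν : Measure S)
    (p : ℝ) (J : Finset (Fin m)) (a : (Fin m → S) → 𝕜) : ℝ≥0∞ :=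
  ∫⁻ y : {k : Fin m // k ∉ J} → S,
      (∫⁻ x : {k : Fin m // k ∈ J} → S,
          ‖a ((Equiv.piEquivPiSubtypeProd (fun k => k ∈ J) fun _ => S).symm (x, y))‖ₑ ^ p
        ∂(Measure.pi fun _ => ν)) ^ (1 / p)
    ∂(Measure.pi fun _ => ν)

/-- Membership in `L¹(S^{J'}, Lᵖ(S^J))`. -/
def MemMixed {m : ℕ} {S 𝕜 : Type*} [MeasurableSpace S] [RCLike 𝕜] (ν : Measure S)
    (p : ℝ) (J : Finset (Fin m)) (a : (Fin m → S) → 𝕜) : Prop :=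
  AEStronglyMeasurable a (Measure.pi fun _ : Fin m => ν) ∧ mixedNorm ν p J a < ∞

/-- `g = ∑ J, a J` almost everywhere, with `a J ∈ L¹(S^{J'}, Lᵖ(S^J))` for every `J ⊆ [1, m]`. -/
def IsDecomposition {m : ℕ} {S 𝕜 : Type*} [MeasurableSpace S] [RCLike 𝕜] (ν : Measure S)
    (p : ℝ) (g : (Fin m → S) → 𝕜) (a : Finset (Fin m) → (Fin m → S) → 𝕜) : Prop :=
  (∀ J, MemMixed ν p J (a J)) ∧
    g =ᵐ[Measure.pi fun _ : Fin m => ν] fun z => ∑ J : Finset (Fin m), a J z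

/-- The norm of `g` in the interpolation sum `∑_{J ⊆ [1, m]} L¹(S^{J'}, Lᵖ(S^J))`
(`∞` if `g` has no decomposition). -/
def sumNorm {m : ℕ} {S 𝕜 : Type*} [MeasurableSpace S] [RCLike 𝕜] (ν : Measure S)
    (p : ℝ) (g : (Fin m → S) → 𝕜) : ℝ≥0∞ :=
  ⨅ (a : Finset (Fin m) → (Fin m → S) → 𝕜) (_ : IsDecomposition ν p g a),
    ∑ J : Finset (Fin m), mixedNorm ν p J (a J)

end DecoupledSum

end

open DecoupledSum

/-!
Write `S` for the disjoint union of `n` copies of `Ω`. A point `w ∈ Ωⁿ` samples the points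
`(i, w i)` of `S`, and the decoupled integral of `f` is the mean of the `ℓᵖ` norm of `f` over the
points of `Sᵐ` whose `m` coordinates are sampled independently. For `A ⊆ [1, m]` let `N_A(z)`
(`sampledNorm`) be the same mean when only the coordinates in `A` are sampled, the other ones being
those of `z`; so `N_∅ = |f|` and `N_[1, m]` is the decoupled integral `D`.

*Lower bound.* For each `J`, the `ℓᵖ` norm over all points is at most the `ℓ¹` norm over the points
in the coordinates outside `J` of the `ℓᵖ` norms in the coordinates in `J`; with Jensen's inequality
in the latter, `D` is at most the norm in `L¹(Lᵖ)` (`IsSampling.sampledNorm_univ_le`). The triangle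
inequality for `D` does the rest.

*Upper bound.* The function is cut along the sets `E_J` where `16 ^ |A| N_A(z)` is maximal at
`A = J` (`maximalSet`). Almost every point at which `f ≠ 0` lies in exactly one of them. On `E_J`:

* The norms in fewer variables satisfy `N_A ≤ 16 ^ |J| N_J` for `A ⊆ J`. Hence for fixed
  coordinates outside `J` all the partial sums of `|f|ᵖ 1_{E_J}` are at most a constant times `N_J ^ p`
  with large probability, and a Paley–Zygmund argument (`IsSampling.lmarginal_le_of_tail`) turns
  this into a bound of the `Lᵖ` norm of `f 1_{E_J}` in the variables in `J` by a constant times `N_J`.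
* The norms in more variables are small, `16 ^ |A| N_{A ∪ J} ≤ N_J` for `A` disjoint from `J`. Since
  the maximum of `N_J` over the points sampled in the variables in `A` has mean at most `N_{A ∪ J}`,
  points where `N_J` is that large are sampled with probability at most `1 / 16`. The same
  Paley–Zygmund argument, for the indicator function of this set of points, shows that the set has
  sections of bounded measure, and a second moment computation gives `∫ N_J ≤ C D` over it
  (`IsSampling.lmarginal_indicator_le`).

Together these bound the norm of `f 1_{E_J}` in `L¹(Lᵖ)` (`IsSampling.lmarginal_maximalSet_le`). All
of this is carried out for an abstract sampling mechanism, `IsSampling`.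
-/

open MeasureTheory
open scoped ENNReal NNReal

namespace DecoupledSum

open ProbabilityTheory Function

/-! ### Marginal integrals -/

section Marginals

variable {ι S : Type*} [DecidableEq ι] [MeasurableSpace S]

theorem lmarginal_congr_measure {μ μ' : ι → Measure S} {A : Finset ι} (h : ∀ k ∈ A, μ k = μ' k)
    (f : (ι → S) → ℝ≥0∞) : ∫⋯∫⁻_A, f ∂μ = ∫⋯∫⁻_A, f ∂μ' := by
  ext z
  have : (fun k : A => μ k) = fun k : A => μ' k := funext fun k => h k k.2
  simp only [lmarginal, this]

theorem lintegral_lmarginal_swap {Y : Type*} [MeasurableSpace Y] (m : Measure Y) [SFinite m]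
    (μ : ι → Measure S) [∀ k, SigmaFinite (μ k)] (A : Finset ι) {H : Y → (ι → S) → ℝ≥0∞}
    (hH : Measurable (uncurry H)) (z : ι → S) :
    ∫⁻ y, (∫⋯∫⁻_A, H y ∂μ) z ∂m = (∫⋯∫⁻_A, (fun w => ∫⁻ y, H y w ∂m) ∂μ) z := by
  simp only [lmarginal]
  rw [lintegral_lintegral_swap]
  exact (hH.comp (measurable_fst.prodMk
    (measurable_updateFinset.comp measurable_snd))).aemeasurable

theorem lmarginal_add (μ : ι → Measure S) [∀ k, SigmaFinite (μ k)] (A : Finset ι)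
    {f g : (ι → S) → ℝ≥0∞} (hf : Measurable f) (z : ι → S) :
    (∫⋯∫⁻_A, (fun w => f w + g w) ∂μ) z = (∫⋯∫⁻_A, f ∂μ) z + (∫⋯∫⁻_A, g ∂μ) z :=
  lintegral_add_left (hf.comp measurable_updateFinset) _

theorem lmarginal_const_mul (μ : ι → Measure S) [∀ k, SigmaFinite (μ k)] (A : Finset ι)
    (c : ℝ≥0∞) {f : (ι → S) → ℝ≥0∞} (hf : Measurable f) (z : ι → S) :
    (∫⋯∫⁻_A, (fun w => c * f w) ∂μ) z = c * (∫⋯∫⁻_A, f ∂μ) z :=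
  lintegral_const_mul _ (hf.comp measurable_updateFinset)

/-- A factor which does not depend on the integrated variables is a constant. -/
theorem lmarginal_mul_of_congr (μ : ι → Measure S) [∀ k, SigmaFinite (μ k)] (A : Finset ι)
    {f g : (ι → S) → ℝ≥0∞} (hf : Measurable f)
    (hg : ∀ w w' : ι → S, (∀ k ∉ A, w k = w' k) → g w = g w') (z : ι → S) :
    (∫⋯∫⁻_A, (fun w => g w * f w) ∂μ) z = g z * (∫⋯∫⁻_A, f ∂μ) z := by
  rw [← lmarginal_const_mul μ A _ hf]
  simp only [lmarginal]
  refine lintegral_congr fun y => ?_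
  rw [hg (updateFinset z A y) z fun k hk => by simp [updateFinset, hk]]

/-- The hypothesis on `μ` (almost every value of a function is at most its integral) holds for sums
of point masses; it is what makes the `ℓᵖ` norms decreasing in `p`. -/
theorem lintegral_rpow_mul_le {μ : Measure S}
    (hμ : ∀ F : S → ℝ≥0∞, Measurable F → ∀ᵐ a ∂μ, F a ≤ ∫⁻ b, F b ∂μ) {F g : S → ℝ≥0∞}
    (hF : Measurable F) (hg : Measurable g) {q : ℝ} (hq : 0 ≤ q) :
    ∫⁻ a, F a ^ q * g a ∂μ ≤ (∫⁻ a, F a ∂μ) ^ q * ∫⁻ a, g a ∂μ := by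
  rw [← lintegral_const_mul _ hg]
  refine lintegral_mono_ae ?_
  filter_upwards [hμ F hF] with a ha
  gcongr

theorem rpow_lintegral_le {μ : Measure S}
    (hμ : ∀ F : S → ℝ≥0∞, Measurable F → ∀ᵐ a ∂μ, F a ≤ ∫⁻ b, F b ∂μ) {F : S → ℝ≥0∞}
    (hF : Measurable F) {q : ℝ} (hq : 0 < q) (hq1 : q ≤ 1) :
    (∫⁻ a, F a ∂μ) ^ q ≤ ∫⁻ a, F a ^ q ∂μ := by
  rw [← ENNReal.le_rpow_inv_iff hq]
  have hr : 0 ≤ q⁻¹ - 1 := sub_nonneg.2 ((one_le_inv₀ hq).2 hq1)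
  have h := lintegral_rpow_mul_le hμ (hF.pow_const q) (hF.pow_const q) hr
  have e : ∀ t : ℝ≥0∞, t ^ (q⁻¹ - 1) * t = t ^ q⁻¹ := fun t => by
    conv_lhs => rw [← ENNReal.rpow_one t, ← ENNReal.rpow_mul, one_mul,
      ← ENNReal.rpow_add_of_nonneg _ _ hr zero_le_one]
    congr 1; ring
  simpa only [e, ← ENNReal.rpow_mul _ q q⁻¹, mul_inv_cancel₀ hq.ne', ENNReal.rpow_one] using h

/-- The weighted sum of `F ^ q` is at most the `q`-th power of the full sum of `F`, times the total
weight. -/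
theorem lmarginal_rpow_mul_le {μ : ι → Measure S} [∀ k, SigmaFinite (μ k)]
    (hμ : ∀ k, ∀ F : S → ℝ≥0∞, Measurable F → ∀ᵐ a ∂μ k, F a ≤ ∫⁻ b, F b ∂μ k)
    (A : Finset ι) {F g : (ι → S) → ℝ≥0∞}
    (hF : Measurable F) (hg : Measurable g) {q : ℝ} (hq : 0 ≤ q) (z : ι → S) :
    (∫⋯∫⁻_A, (fun w => F w ^ q * g w) ∂μ) z ≤ (∫⋯∫⁻_A, F ∂μ) z ^ q * (∫⋯∫⁻_A, g ∂μ) z := by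
  induction A using Finset.induction generalizing z with
  | empty => simp
  | insert k A hk ih =>
    rw [lmarginal_insert (fun w => F w ^ q * g w) ((hF.pow_const q).mul hg) hk, lmarginal_insert _ hF hk,
      lmarginal_insert _ hg hk]
    exact (lintegral_mono fun a => ih _).trans (lintegral_rpow_mul_le (hμ k)
      ((hF.lmarginal μ).comp (measurable_update z)) ((hg.lmarginal μ).comp (measurable_update z))
      hq)

theorem rpow_lmarginal_le {μ : ι → Measure S} [∀ k, SigmaFinite (μ k)]
    (hμ : ∀ k, ∀ F : S → ℝ≥0∞, Measurable F → ∀ᵐ a ∂μ k, F a ≤ ∫⁻ b, F b ∂μ k)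
    (A : Finset ι) {F : (ι → S) → ℝ≥0∞}
    (hF : Measurable F) {q : ℝ} (hq : 0 < q) (hq1 : q ≤ 1) (z : ι → S) :
    (∫⋯∫⁻_A, F ∂μ) z ^ q ≤ (∫⋯∫⁻_A, (fun w => F w ^ q) ∂μ) z := by
  induction A using Finset.induction generalizing z with
  | empty => simp
  | insert k A hk ih =>
    rw [lmarginal_insert _ hF hk, lmarginal_insert _ (hF.pow_const q) hk]
    exact (rpow_lintegral_le (hμ k) ((hF.lmarginal μ).comp (measurable_update z)) hq hq1).trans
      (lintegral_mono fun a => ih _)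

theorem lmarginal_one_le {μ : ι → Measure S} [∀ k, SigmaFinite (μ k)] {R : ℝ≥0∞}
    (hμ : ∀ k, μ k Set.univ ≤ R) (A : Finset ι) (z : ι → S) :
    (∫⋯∫⁻_A, (fun _ => 1) ∂μ) z ≤ R ^ A.card := by
  induction A using Finset.induction generalizing z with
  | empty => simp
  | insert k A hk ih =>
    rw [lmarginal_insert _ measurable_const hk, Finset.card_insert_of_notMem hk, pow_succ]
    refine (lintegral_mono fun a => ih _).trans ?_
    rw [lintegral_const]
    gcongr
    exact hμ k

end Marginals

/-! ### Independence of the samples -/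

section Resampling

theorem measurable_piecewise_pair {ι W : Type*} [DecidableEq ι] [MeasurableSpace W]
    (A : Finset ι) :
    Measurable fun q : (ι → W) × (ι → W) => A.piecewise q.1 q.2 := by
  refine measurable_pi_iff.2 fun k => ?_
  by_cases hk : k ∈ A
  · simp only [Finset.piecewise, hk, if_true]; fun_prop
  · simp only [Finset.piecewise, hk, if_false]; fun_prop

variable {ι W : Type*} [Fintype ι] [DecidableEq ι] [MeasurableSpace W] (P : Measure W)
  [IsProbabilityMeasure P]

theorem lintegral_pi_resample (k : ι) {Ψ : (ι → W) → ℝ≥0∞} (hΨ : Measurable Ψ) :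
    ∫⁻ x, ∫⁻ w, Ψ (update x k w) ∂P ∂(Measure.pi fun _ => P) = ∫⁻ x, Ψ x ∂Measure.pi fun _ => P := by
  refine lintegral_eq_of_lmarginal_eq {k} ?_ hΨ ?_
  · exact Measurable.lintegral_prod_right (hΨ.comp measurable_update')
  · simp [lmarginal_singleton]

/-- Merging two independent samples, one for the indices in `A` and one for the others, gives a
sample. -/
theorem lintegral_pi_piecewise (A : Finset ι) {Ψ : (ι → W) → ℝ≥0∞} (hΨ : Measurable Ψ) :
    ∫⁻ x, ∫⁻ y, Ψ (A.piecewise x y) ∂(Measure.pi fun _ => P) ∂(Measure.pi fun _ => P) =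
      ∫⁻ x, Ψ x ∂Measure.pi fun _ => P := by
  induction A using Finset.induction generalizing Ψ with
  | empty => simp
  | insert k A hk ih =>
    have hΨ' : Measurable fun x => ∫⁻ w, Ψ (update x k w) ∂P :=
      Measurable.lintegral_prod_right (hΨ.comp measurable_update')
    rw [← lintegral_pi_resample P k hΨ, ← ih hΨ', ← lintegral_pi_resample P k]
    · refine lintegral_congr fun x => ?_
      rw [lintegral_lintegral_swap]
      · refine lintegral_congr fun y => lintegral_congr fun w => ?_
        congr 1
        rw [Finset.piecewise_insert]
        ext j
        by_cases hj : j = k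
        · subst hj; simp
        · by_cases hjA : j ∈ A <;> simp [hj, hjA]
      · refine (hΨ.comp ((measurable_piecewise_pair _).comp
            (Measurable.prodMk ?_ measurable_snd))).aemeasurable
        exact (measurable_update x).comp measurable_fst
    · exact Measurable.lintegral_prod_right (hΨ.comp (measurable_piecewise_pair _))

/-- If `G x y` depends on `x` through the indices in `A` and on `y` through the other ones, then `x`
and `y` may be taken independent or equal. -/
theorem lintegral_pi_pair (A : Finset ι) {G : (ι → W) → (ι → W) → ℝ≥0∞}
    (hG : Measurable (uncurry G))
    (hA : ∀ x x' y y' : ι → W, (∀ k ∈ A, x k = x' k) → (∀ k ∉ A, y k = y' k) → G x y = G x' y') :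
    ∫⁻ x, ∫⁻ y, G x y ∂(Measure.pi fun _ => P) ∂(Measure.pi fun _ => P) =
      ∫⁻ x, G x x ∂Measure.pi fun _ => P := by
  rw [← lintegral_pi_piecewise P A (Ψ := fun x => G x x)
    (hG.comp (measurable_id.prodMk measurable_id))]
  refine lintegral_congr fun x => lintegral_congr fun y => ?_
  exact hA _ _ _ _ (fun k hk => by simp [hk]) fun k hk => by simp [hk]

end Resampling

/-! ### Sums over sampled points -/

section SampleSum

variable {ι S W : Type*} [DecidableEq ι] [MeasurableSpace S] [MeasurableSpace W]

/-- For a random measure `κ w` on `S`, the integral of `h` in the variables with index in `A`,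
the `k`-th variable being integrated against `κ (x k)`; the other variables are those of `z`. If
`κ w` is a sum of point masses, this is a sum over all ways to choose, for each `k ∈ A`, a point
sampled by `x k`. -/
noncomputable def sampleSum (κ : Kernel W S) (A : Finset ι) (h : (ι → S) → ℝ≥0∞) (x : ι → W)
    (z : ι → S) : ℝ≥0∞ :=
  (∫⋯∫⁻_A, h ∂fun k => κ (x k)) z

variable (κ : Kernel W S)

theorem sampleSum_congr {A : Finset ι} (h : (ι → S) → ℝ≥0∞) {x x' : ι → W} {z z' : ι → S}
    (hx : ∀ k ∈ A, x k = x' k) (hz : ∀ k ∉ A, z k = z' k) :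
    sampleSum κ A h x z = sampleSum κ A h x' z' := by
  rw [sampleSum, lmarginal_congr _ h hz,
    lmarginal_congr_measure (fun k hk => by rw [hx k hk]), sampleSum]

variable [IsFiniteKernel κ]

theorem measurable_sampleSum_param {Y : Type*} [MeasurableSpace Y] (A : Finset ι)
    {H : Y → (ι → S) → ℝ≥0∞} (hH : Measurable (uncurry H)) :
    Measurable fun q : Y × (ι → W) × (ι → S) => sampleSum κ A (H q.1) q.2.1 q.2.2 := by
  induction A using Finset.induction with
  | empty =>
    simp only [sampleSum, lmarginal_empty]
    exact hH.comp (measurable_fst.prodMk measurable_snd.snd)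
  | insert k A hk ih =>
    have hx : Measurable fun q : Y × (ι → W) × (ι → S) => q.2.1 k :=
      (measurable_pi_apply k).comp measurable_snd.fst
    have e : (fun q : Y × (ι → W) × (ι → S) => sampleSum κ (insert k A) (H q.1) q.2.1 q.2.2) =
        fun q => ∫⁻ a, sampleSum κ A (H q.1) q.2.1 (update q.2.2 k a)
          ∂(κ.comap (fun q : Y × (ι → W) × (ι → S) => q.2.1 k) hx) q := by
      ext q
      simp only [sampleSum, Kernel.comap_apply]
      exact lmarginal_insert (H q.1) (hH.comp measurable_prodMk_left) hk _
    rw [e]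
    refine Measurable.lintegral_kernel_prod_right
      (f := fun (q : Y × (ι → W) × (ι → S)) a => sampleSum κ A (H q.1) q.2.1 (update q.2.2 k a)) ?_
    exact ih.comp (measurable_fst.fst.prodMk (measurable_fst.snd.fst.prodMk
      (measurable_update'.comp (measurable_fst.snd.snd.prodMk measurable_snd))))

theorem measurable_sampleSum {Y : Type*} [MeasurableSpace Y] (A : Finset ι)
    {h : (ι → S) → ℝ≥0∞} (hh : Measurable h) {u : Y → ι → W} (hu : Measurable u)
    {v : Y → ι → S} (hv : Measurable v) : Measurable fun y => sampleSum κ A h (u y) (v y) :=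
  (measurable_sampleSum_param κ A (Y := Unit) (H := fun _ => h)
    (hh.comp measurable_snd)).comp (measurable_const.prodMk (hu.prodMk hv) : Measurable
      fun y => ((), u y, v y))

theorem sampleSum_insert {A : Finset ι} {k : ι} (hk : k ∉ A) {h : (ι → S) → ℝ≥0∞}
    (hh : Measurable h) (x : ι → W) (z : ι → S) :
    sampleSum κ (insert k A) h x z = ∫⁻ a, sampleSum κ A h x (update z k a) ∂κ (x k) :=
  lmarginal_insert h hh hk z

theorem sampleSum_union {A B : Finset ι} (hAB : Disjoint A B) {h : (ι → S) → ℝ≥0∞}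
    (hh : Measurable h) (x : ι → W) (z : ι → S) :
    sampleSum κ (A ∪ B) h x z = sampleSum κ A (fun w => sampleSum κ B h x w) x z := by
  unfold sampleSum
  rw [lmarginal_union _ h hh hAB]

end SampleSum

/-! ### First and second moments of sample sums, and a Paley–Zygmund bound -/

/-- `κ w` is the random finite set of points (a sum of point masses) sampled by `w`, where `w` has
law `P`. Its intensity is `ν`, pairs of distinct points are at most as frequent as they would be if
they were independent (the summand `Measure.dirac a` accounts for a point paired with itself), and
the number of points is at most `R`. That `κ w` is a sum of point masses is recorded by
`le_lintegral` only: almost every value of a function is at most its sum over the points. -/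
structure IsSampling {S W : Type*} [MeasurableSpace S] [MeasurableSpace W] (P : Measure W)
    (κ : Kernel W S) (ν : Measure S) (R : ℝ≥0) : Prop where
  intensity : ∀ φ : S → ℝ≥0∞, Measurable φ → ∫⁻ w, ∫⁻ a, φ a ∂κ w ∂P = ∫⁻ a, φ a ∂ν
  pair : ∀ Φ : S → S → ℝ≥0∞, Measurable (uncurry Φ) →
    ∫⁻ w, ∫⁻ a, ∫⁻ b, Φ a b ∂κ w ∂κ w ∂P ≤ ∫⁻ a, ∫⁻ b, Φ a b ∂(ν + Measure.dirac a) ∂ν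
  le_lintegral : ∀ w, ∀ F : S → ℝ≥0∞, Measurable F → ∀ᵐ a ∂κ w, F a ≤ ∫⁻ b, F b ∂κ w
  mass : ∀ w, κ w Set.univ ≤ R

section Moments

variable {ι S W : Type*} [DecidableEq ι] [MeasurableSpace S] [MeasurableSpace W]

theorem lintegral_lmarginal_update (m : Measure S) [SFinite m]
    (μ : ι → Measure S) [∀ k, SigmaFinite (μ k)] {A : Finset ι} {k : ι} (hk : k ∉ A)
    {h : (ι → S) → ℝ≥0∞} (hh : Measurable h) (z : ι → S) :
    ∫⁻ b, (∫⋯∫⁻_A, h ∂μ) (update z k b) ∂m =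
      (∫⋯∫⁻_A, (fun w => ∫⁻ b, h (update w k b) ∂m) ∂μ) z := by
  rw [← lintegral_lmarginal_swap m μ A (H := fun b w => h (update w k b))
    (hh.comp (measurable_update'.comp measurable_swap))]
  exact lintegral_congr fun b => lmarginal_update_of_notMem hh hk z b

/-- Integrating against `ν + δ` amounts to choosing the variables which are frozen by `δ` and
integrating out the others against `ν`. -/
theorem lmarginal_add_dirac_le (ν : Measure S) [SigmaFinite ν] (s : ι → S) (c : ℝ≥0∞)
    (A : Finset ι) {h : (ι → S) → ℝ≥0∞} (hh : Measurable h) (z : ι → S)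
    (hc : ∀ A' ⊂ A, ∀ z' : ι → S, (∀ k ∉ A, z' k = z k) → (∫⋯∫⁻_A', h ∂fun _ => ν) z' ≤ c) :
    (∫⋯∫⁻_A, h ∂fun k => ν + Measure.dirac (s k)) z ≤
      (∫⋯∫⁻_A, h ∂fun _ => ν) z + ((2 ^ A.card - 1 : ℕ) : ℝ≥0∞) * c := by
  induction A using Finset.induction generalizing h z with
  | empty => simp
  | insert k A hk ih =>
    have hm1 : Measurable fun w : ι → S => ∫⁻ b, h (update w k b) ∂ν :=
      Measurable.lintegral_prod_right (hh.comp measurable_update')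
    have hm2 : Measurable fun w : ι → S => h (update w k (s k)) := hh.comp measurable_update_left
    have hsub : ∀ A' ⊂ A, insert k A' ⊂ insert k A := fun A' hA' =>
      (Finset.ssubset_iff_subset_ne.2 ⟨Finset.insert_subset_insert _ hA'.subset, fun e => hA'.ne <| by
        rw [← Finset.erase_insert hk, ← e, Finset.erase_insert fun h => hk (hA'.subset h)]⟩)
    have h1 := ih hm1 z fun A' hA' z' hz' => by
      rw [← lmarginal_insert' h hh fun h => hk (hA'.subset h)]
      exact hc _ (hsub A' hA') z' fun j hj => hz' j fun h => hj (Finset.mem_insert_of_mem h)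
    have h2' : ∀ A' ⊆ A, ∀ z' : ι → S, (∀ j ∉ A, z' j = z j) →
        (∫⋯∫⁻_A', (fun w => h (update w k (s k))) ∂fun _ => ν) z' ≤ c := fun A' hA' z' hz' => by
      have e := lmarginal_update_of_notMem (μ := fun _ : ι => ν) hh (fun h => hk (hA' h)) z' (s k)
      refine (le_of_eq e.symm).trans (hc _ ?_ _ ?_)
      · exact (Finset.ssubset_insert hk).trans_le' hA'
      · intro j hj
        rw [Finset.mem_insert, not_or] at hj
        rw [update_of_ne hj.1, hz' j hj.2]
    have h2 := ih hm2 z fun A' hA' => h2' A' hA'.subset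
    rw [lmarginal_insert' h hh hk, lmarginal_insert' h hh hk]
    have e : (fun w : ι → S => ∫⁻ b, h (update w k b) ∂(ν + Measure.dirac (s k))) =
        fun w => ∫⁻ b, h (update w k b) ∂ν + h (update w k (s k)) := by
      ext w
      rw [lintegral_add_measure,
        lintegral_dirac' (f := fun b => h (update w k b)) _ (hh.comp (measurable_update w))]
    rw [e, lmarginal_add _ _ hm1]
    refine (add_le_add h1 (h2.trans (add_le_add_left (h2' A subset_rfl z fun _ _ => rfl) _))).trans ?_
    rw [Finset.card_insert_of_notMem hk, add_assoc]
    refine add_le_add_right (le_of_eq ?_) _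
    obtain ⟨n, hn⟩ : ∃ n, 2 ^ A.card = n + 1 := Nat.exists_eq_succ_of_ne_zero (by positivity)
    rw [pow_succ, hn, show (n + 1) * 2 - 1 = n + (1 + n) by omega, show n + 1 - 1 = n by omega]
    push_cast
    ring

theorem IsSampling.sampleSum_one_le {P : Measure W} {ν : Measure S}
    {R : ℝ≥0} {κ : Kernel W S} [IsFiniteKernel κ] (hS : IsSampling P κ ν R) (A : Finset ι)
    {g : (ι → S) → ℝ≥0∞}
    (hg : ∀ w, g w ≤ 1) (x : ι → W) (z : ι → S) : sampleSum κ A g x z ≤ R ^ A.card :=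
  (lmarginal_mono (f := g) (g := fun _ => 1) hg z).trans
    (lmarginal_one_le (fun k => hS.mass (x k)) A z)

variable [Fintype ι] {P : Measure W} [IsProbabilityMeasure P] {κ : Kernel W S} [IsFiniteKernel κ]
  {ν : Measure S} [IsFiniteMeasure ν] {R : ℝ≥0}

/-- Campbell's formula in several variables. -/
theorem IsSampling.lintegral_sampleSum (hS : IsSampling P κ ν R) (A : Finset ι)
    {h : (ι → S) → ℝ≥0∞} (hh : Measurable h) (z : ι → S) :
    ∫⁻ x, sampleSum κ A h x z ∂(Measure.pi fun _ => P) = (∫⋯∫⁻_A, h ∂fun _ => ν) z := by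
  induction A using Finset.induction generalizing z with
  | empty => simp [sampleSum]
  | insert k A hk ih =>
    rw [← lintegral_pi_resample P k (Ψ := fun x => sampleSum κ (insert k A) h x z)
      (measurable_sampleSum κ (insert k A) hh measurable_id measurable_const), lmarginal_insert h hh hk]
    simp_rw [← ih]
    rw [lintegral_lintegral_swap (f := fun a x => sampleSum κ A h x (update z k a))
      (measurable_sampleSum κ A hh measurable_snd
        ((measurable_update z).comp measurable_fst)).aemeasurable]
    refine lintegral_congr fun x => ?_
    rw [← hS.intensity _ (measurable_sampleSum κ A hh measurable_const (measurable_update z))]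
    refine lintegral_congr fun w => ?_
    simp only [sampleSum_insert κ hk hh, update_self]
    refine lintegral_congr fun a => sampleSum_congr κ h (fun j hj => ?_) fun _ _ => rfl
    rw [update_of_ne (ne_of_mem_of_not_mem hj hk)]

/-- Mixed second moments of two sample sums: given the points counted by the first sum, the second
one sees at most the intensity and these points themselves. -/
theorem IsSampling.lintegral_sampleSum_mul_le (hS : IsSampling P κ ν R) (A : Finset ι)
    {g h : (ι → S) → ℝ≥0∞} (hg : Measurable g) (hh : Measurable h) (z z' : ι → S) (c : ℝ≥0∞)
    (hc : ∀ s : ι → S, (∫⋯∫⁻_A, h ∂fun k => ν + Measure.dirac (s k)) z' ≤ c) :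
    ∫⁻ x, sampleSum κ A g x z * sampleSum κ A h x z' ∂(Measure.pi fun _ => P) ≤
      (∫⋯∫⁻_A, g ∂fun _ => ν) z * c := by
  induction A using Finset.induction generalizing z h with
  | empty =>
    simp only [sampleSum, lmarginal_empty] at hc ⊢
    rw [lintegral_const, measure_univ, mul_one]
    gcongr
    exact hc z
  | insert k A hk ih =>
    rw [← lintegral_pi_resample P k
      (Ψ := fun x => sampleSum κ (insert k A) g x z * sampleSum κ (insert k A) h x z')
      ((measurable_sampleSum κ (insert k A) hg measurable_id measurable_const).mul
        (measurable_sampleSum κ (insert k A) hh measurable_id measurable_const))]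
    have hup : ∀ (f : (ι → S) → ℝ≥0∞), Measurable f → ∀ (x : ι → W) (w : W) (y : ι → S),
        sampleSum κ (insert k A) f (update x k w) y =
          ∫⁻ a, sampleSum κ A f x (update y k a) ∂κ w := fun f hf x w y => by
      rw [sampleSum_insert κ hk hf, update_self]
      refine lintegral_congr fun a => sampleSum_congr κ f (fun j hj => ?_) fun _ _ => rfl
      rw [update_of_ne (ne_of_mem_of_not_mem hj hk)]
    have hmh1 : ∀ a : S, Measurable fun w : ι → S =>
        ∫⁻ b, h (update w k b) ∂(ν + Measure.dirac a) := fun a =>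
      Measurable.lintegral_prod_right (hh.comp measurable_update')
    calc _ ≤ ∫⁻ x, ∫⁻ a, ∫⁻ b, sampleSum κ A g x (update z k a) * sampleSum κ A h x (update z' k b)
            ∂(ν + Measure.dirac a) ∂ν ∂(Measure.pi fun _ => P) := by
          refine lintegral_mono fun x => ?_
          refine le_trans (le_of_eq ?_) (hS.pair (fun a b => sampleSum κ A g x (update z k a) *
            sampleSum κ A h x (update z' k b)) ?_)
          · refine lintegral_congr fun w => ?_
            simp only [hup g hg, hup h hh]
            rw [← lintegral_mul_const _
              (measurable_sampleSum κ A hg measurable_const (measurable_update z))]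
            refine lintegral_congr fun a => ?_
            rw [← lintegral_const_mul _
              (measurable_sampleSum κ A hh measurable_const (measurable_update z'))]
          · exact (measurable_sampleSum κ A hg measurable_const
              ((measurable_update z).comp measurable_fst)).mul
              (measurable_sampleSum κ A hh measurable_const
                ((measurable_update z').comp measurable_snd))
      _ = ∫⁻ x, ∫⁻ a, sampleSum κ A g x (update z k a) *
            sampleSum κ A (fun w => ∫⁻ b, h (update w k b) ∂(ν + Measure.dirac a)) x z'
            ∂ν ∂(Measure.pi fun _ => P) := by
          refine lintegral_congr fun x => lintegral_congr fun a => ?_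
          rw [lintegral_const_mul _ (measurable_sampleSum κ A hh measurable_const (measurable_update z'))]
          congr 1
          exact lintegral_lmarginal_update _ _ hk hh z'
      _ = ∫⁻ a, ∫⁻ x, sampleSum κ A g x (update z k a) *
            sampleSum κ A (fun w => ∫⁻ b, h (update w k b) ∂(ν + Measure.dirac a)) x z'
            ∂(Measure.pi fun _ => P) ∂ν := by
          refine lintegral_lintegral_swap (Measurable.aemeasurable ?_)
          refine (measurable_sampleSum κ A hg measurable_fst
            ((measurable_update z).comp measurable_snd)).mul ?_
          have hJ : Measurable fun q : S × (ι → S) =>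
              ∫⁻ b, h (update q.2 k b) ∂(ν + Measure.dirac q.1) := by
            have e : (fun q : S × (ι → S) => ∫⁻ b, h (update q.2 k b) ∂(ν + Measure.dirac q.1)) =
                fun q => ∫⁻ b, h (update q.2 k b) ∂ν + h (update q.2 k q.1) := by
              ext q
              rw [lintegral_add_measure, lintegral_dirac' (f := fun b => h (update q.2 k b)) _
                (hh.comp (measurable_update q.2))]
            rw [e]
            refine Measurable.add ?_ (hh.comp (measurable_update'.comp measurable_swap))
            exact Measurable.lintegral_prod_right (f := fun (q : S × (ι → S)) (b : S) =>
              h (update q.2 k b))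
              (hh.comp (measurable_update'.comp (measurable_fst.snd.prodMk measurable_snd)))
          exact (measurable_sampleSum_param κ A (H := fun a w =>
            ∫⁻ b, h (update w k b) ∂(ν + Measure.dirac a)) hJ).comp
            (measurable_snd.prodMk (measurable_fst.prodMk measurable_const))
      _ ≤ ∫⁻ a, (∫⋯∫⁻_A, g ∂fun _ => ν) (update z k a) * c ∂ν := by
          refine lintegral_mono fun a => ih (hmh1 a) (update z k a) fun s => ?_
          refine le_trans (le_of_eq ?_) (hc (update s k a))
          rw [lmarginal_insert' h hh hk, update_self]
          refine congrFun (lmarginal_congr_measure (fun j hj => ?_) _) z'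
          rw [update_of_ne (ne_of_mem_of_not_mem hj hk)]
      _ = _ := by
          rw [lintegral_mul_const (f := fun a => (∫⋯∫⁻_A, g ∂fun _ => ν) (update z k a)) _
              ((hg.lmarginal _).comp (measurable_update z)),
            lmarginal_insert g hg hk]

/-- The pointwise form of the Paley–Zygmund inequality: when `S` is integrated, `M` being its mean,
the left side becomes `8 * M ^ 2`, while a second moment at most `2 * M ^ 2` and
`P (S > M / 2) ≤ 1 / 16` make the right side at most `7 * M ^ 2`. -/
theorem eight_mul_le (M S : ℝ≥0∞) :
    8 * M * S ≤ 4 * M * M + S * S + if M < 2 * S then 16 * M * M else 0 := by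
  rcases eq_or_ne S ∞ with rfl | hS
  · simp
  rcases eq_or_ne M ∞ with rfl | hM
  · simp
  lift S to ℝ≥0 using hS
  lift M to ℝ≥0 using hM
  split_ifs with h
  · have : 8 * (M : ℝ) * S ≤ 4 * M * M + S * S + 16 * M * M := by
      nlinarith [sq_nonneg ((S : ℝ) - 4 * M), mul_nonneg M.2 M.2]
    exact_mod_cast this
  · rw [not_lt] at h
    have h' : 2 * (S : ℝ) ≤ M := by exact_mod_cast h
    have : 8 * (M : ℝ) * S ≤ 4 * M * M + S * S := by
      nlinarith [mul_nonneg S.2 S.2, mul_le_mul_of_nonneg_left h' M.2]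
    rw [add_zero]
    exact_mod_cast this

/-- If, for every choice of frozen variables, the sample sum of `h` in the remaining ones exceeds
`s` with small probability only, then the integral of `h` is at most a constant times `s`. By
induction the partial integrals of `h` are at most a constant times `s`, so that the second moment
of the sample sum is at most twice the square of its mean if the mean is much larger than `s`; then
the sample sum exceeds half its mean with probability greater than `1 / 16`. -/
theorem IsSampling.lmarginal_le_of_tail (hS : IsSampling P κ ν R) (A : Finset ι)
    {h : (ι → S) → ℝ≥0∞} (hh : Measurable h) (z : ι → S) (s : ℝ≥0∞)
    (hA : ∀ A' ⊆ A, ∀ z' : ι → S, (∀ k ∉ A, z' k = z k) →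
      (Measure.pi fun _ => P) {x | s < sampleSum κ A' h x z'} ≤ 1 / 16) :
    (∫⋯∫⁻_A, h ∂fun _ => ν) z ≤ 2 ^ A.card ^ 2 * s := by
  induction A using Finset.strongInduction generalizing z with
  | H A ih =>
  -- The case `A' = ∅` of the hypothesis is a pointwise bound: a constant exceeds `s` with
  -- probability `0` or `1`.
  have hpt : ∀ z' : ι → S, (∀ k ∉ A, z' k = z k) → h z' ≤ s := fun z' hz' => by
    by_contra! hlt
    have := hA ∅ (Finset.empty_subset _) z' hz'
    simp only [sampleSum, lmarginal_empty, hlt, Set.ofPred_true, measure_univ] at this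
    norm_num at this
  rcases A.eq_empty_or_nonempty with rfl | hne
  · simpa using hpt z fun _ _ => rfl
  rcases eq_or_ne s ∞ with rfl | hs
  · simp
  set M := (∫⋯∫⁻_A, h ∂fun _ => ν) z with hM
  have hMtop : M ≠ ∞ := by
    refine ne_top_of_le_ne_top ?_ (lintegral_mono (g := fun _ => s) fun y => ?_)
    · rw [lintegral_const]
      exact ENNReal.mul_ne_top hs (measure_ne_top _ _)
    · exact hpt _ fun k hk => by simp [updateFinset, hk]
  by_contra! hlt
  set d := A.card with hd
  have hd1 : 1 ≤ d := hne.card_pos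
  have hsec : ∀ A' ⊂ A, ∀ z' : ι → S, (∀ k ∉ A, z' k = z k) →
      (∫⋯∫⁻_A', h ∂fun _ => ν) z' ≤ 2 ^ (d - 1) ^ 2 * s := fun A' hA' z' hz' => by
    refine (ih A' hA' z' fun B hB z'' hz'' => hA B (hB.trans hA'.subset) z'' fun k hk => ?_).trans ?_
    · rw [hz'' k fun h => hk (hA'.subset h), hz' k hk]
    · have : A'.card < d := Finset.card_lt_card hA'
      gcongr
      · norm_num
      · omega
  have hexp : (2 ^ d : ℝ≥0∞) * (2 ^ (d - 1) ^ 2 * s) ≤ M := by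
    refine le_trans ?_ hlt.le
    rw [← mul_assoc, ← pow_add]
    gcongr
    · norm_num
    · obtain ⟨e, he⟩ := Nat.exists_eq_add_of_le hd1
      rw [he]
      ring_nf
      simp
      nlinarith
  have h2s : 2 * s ≤ M := by
    refine le_trans ?_ hlt.le
    gcongr
    calc (2 : ℝ≥0∞) = 2 ^ 1 := (pow_one _).symm
      _ ≤ 2 ^ d ^ 2 := by
        gcongr
        · norm_num
        · exact Nat.one_le_pow _ _ hd1
  have hM0 : M ≠ 0 := (lt_of_le_of_lt zero_le hlt).ne'
  have hmS : Measurable fun x : ι → W => sampleSum κ A h x z :=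
    measurable_sampleSum κ A hh measurable_id measurable_const
  have hsq : ∫⁻ x, sampleSum κ A h x z * sampleSum κ A h x z ∂(Measure.pi fun _ => P) ≤
      M * (2 * M) := by
    refine hS.lintegral_sampleSum_mul_le A hh hh z z _ fun t => ?_
    refine (lmarginal_add_dirac_le ν t _ A hh z hsec).trans ?_
    rw [two_mul]
    refine add_le_add_right (le_trans ?_ hexp) _
    gcongr
    rw [← hd]
    exact_mod_cast Nat.sub_le _ _
  have key : 8 * M * M ≤ 7 * M * M := by
    calc 8 * M * M = ∫⁻ x, 8 * M * sampleSum κ A h x z ∂(Measure.pi fun _ => P) := by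
          rw [lintegral_const_mul _ hmS, hS.lintegral_sampleSum A hh z]
      _ ≤ ∫⁻ x, (4 * M * M + sampleSum κ A h x z * sampleSum κ A h x z +
            {x | M < 2 * sampleSum κ A h x z}.indicator (fun _ => 16 * M * M) x)
            ∂(Measure.pi fun _ => P) := by
          refine lintegral_mono fun x => (eight_mul_le _ _).trans (le_of_eq ?_)
          simp [Set.indicator_apply]
      _ = 4 * M * M + ∫⁻ x, sampleSum κ A h x z * sampleSum κ A h x z ∂(Measure.pi fun _ => P) +
            16 * M * M * (Measure.pi fun _ => P) {x | M < 2 * sampleSum κ A h x z} := by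
          rw [lintegral_add_left (f := fun x => 4 * M * M + sampleSum κ A h x z * sampleSum κ A h x z)
              (measurable_const.add (hmS.mul hmS)),
            lintegral_add_left measurable_const, lintegral_const, measure_univ, mul_one,
            lintegral_indicator_const (measurableSet_lt measurable_const (hmS.const_mul 2))]
      _ ≤ 4 * M * M + M * (2 * M) + 16 * M * M * (1 / 16) := by
          gcongr
          refine (measure_mono fun x hx => ?_).trans (hA A subset_rfl z fun _ _ => rfl)
          exact (ENNReal.mul_lt_mul_iff_right two_ne_zero ENNReal.ofNat_ne_top).1
            (h2s.trans_lt hx)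
      _ = 7 * M * M := by
          rw [show 16 * M * M * (1 / 16) = M * M * (16 * (1 / 16)) by ring,
            one_div, ENNReal.mul_inv_cancel (by norm_num) (by norm_num)]
          ring
  clear_value M
  lift M to ℝ≥0 using hMtop
  have hpos : 0 < (M : ℝ) := by
    have : M ≠ 0 := by exact_mod_cast hM0
    positivity
  have key' : 8 * (M : ℝ) * M ≤ 7 * M * M := by exact_mod_cast key
  nlinarith [mul_pos hpos hpos]

end Moments

/-! ### Averaged norms over sampled points -/

section SampledNorm

variable {ι S W : Type*} [Fintype ι] [DecidableEq ι] [MeasurableSpace S] [MeasurableSpace W]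

/-- The `ℓᵖ` norm of `f` over the sampled points in the variables with index in `A`, averaged over
the samples; the variables outside `A` are those of `z`. -/
noncomputable def sampledNorm (P : Measure W) (κ : Kernel W S) (p : ℝ) (A : Finset ι)
    (f : (ι → S) → ℝ≥0∞) (z : ι → S) : ℝ≥0∞ :=
  ∫⁻ x, sampleSum κ A (fun w => f w ^ p) x z ^ (1 / p) ∂(Measure.pi fun _ => P)

variable {P : Measure W} {κ : Kernel W S} {ν : Measure S} {R : ℝ≥0} {p : ℝ}
  {f : (ι → S) → ℝ≥0∞}

theorem sampledNorm_congr {A : Finset ι} {z z' : ι → S} (hz : ∀ k ∉ A, z k = z' k) :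
    sampledNorm P κ p A f z = sampledNorm P κ p A f z' :=
  lintegral_congr fun x => by rw [sampleSum_congr κ _ (fun _ _ => rfl) hz]

variable [IsProbabilityMeasure P]

theorem sampledNorm_empty (hp : 1 ≤ p) (z : ι → S) : sampledNorm P κ p ∅ f z = f z := by
  simp only [sampledNorm, sampleSum, lmarginal_empty, lintegral_const, measure_univ, mul_one,
    ← ENNReal.rpow_mul, mul_one_div_cancel (zero_lt_one.trans_le hp).ne', ENNReal.rpow_one]

variable [IsFiniteKernel κ]

theorem measurable_sampledNorm (p : ℝ) (A : Finset ι) (hf : Measurable f) :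
    Measurable (sampledNorm P κ p A f) :=
  Measurable.lintegral_prod_left (f := fun x z => sampleSum κ A (fun w => f w ^ p) x z ^ (1 / p))
    ((measurable_sampleSum κ A (hf.pow_const p) measurable_fst measurable_snd).pow_const _)

theorem lintegral_lintegral_sampleSum {A B : Finset ι} (hAB : Disjoint A B) (hf : Measurable f)
    (z : ι → S) :
    ∫⁻ x, ∫⁻ y, sampleSum κ A (fun w => sampleSum κ B (fun w => f w ^ p) y w) x z ^ (1 / p)
      ∂(Measure.pi fun _ => P) ∂(Measure.pi fun _ => P) = sampledNorm P κ p (A ∪ B) f z := by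
  rw [lintegral_pi_pair P A (G := fun x y =>
    sampleSum κ A (fun w => sampleSum κ B (fun w => f w ^ p) y w) x z ^ (1 / p))]
  · simp_rw [sampledNorm, sampleSum_union κ hAB (hf.pow_const p)]
  · refine Measurable.pow_const ?_ _
    exact (measurable_sampleSum_param κ A
      (H := fun y w => sampleSum κ B (fun w => f w ^ p) y w)
      (measurable_sampleSum κ B (hf.pow_const p) measurable_fst measurable_snd)).comp
      (measurable_snd.prodMk (measurable_fst.prodMk measurable_const))
  · intro x x' y y' hx hy
    congr 1
    rw [sampleSum_congr κ _ hx fun _ _ => rfl]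
    refine congrArg (fun h => sampleSum κ A h x' z) (funext fun w => ?_)
    exact sampleSum_congr κ _ (fun k hk => hy k (Finset.disjoint_right.1 hAB hk)) fun _ _ => rfl

/-- On the points sampled in the variables `A`, the norm in the variables `B` is dominated by a
single function of the samples whose mean is the norm in the variables `A ∪ B`. -/
theorem IsSampling.exists_dominating (hS : IsSampling P κ ν R) (hp : 1 ≤ p) {A B : Finset ι}
    (hAB : Disjoint A B) (hf : Measurable f) (z : ι → S) :
    ∃ U : (ι → W) → ℝ≥0∞, Measurable U ∧
      ∫⁻ x, U x ∂(Measure.pi fun _ => P) = sampledNorm P κ p (A ∪ B) f z ∧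
      ∀ (g : (ι → S) → ℝ≥0∞), Measurable g → ∀ x,
        sampleSum κ A (fun w => sampledNorm P κ p B f w * g w) x z ≤
          U x * sampleSum κ A g x z := by
  have hB := measurable_sampleSum κ B (hf.pow_const p) (measurable_fst (α := ι → W) (β := ι → S))
    measurable_snd
  have hm := (measurable_sampleSum_param κ A
      (H := fun y w => sampleSum κ B (fun w => f w ^ p) y w) hB).comp
      (measurable_snd.prodMk (measurable_fst.prodMk measurable_const) :
        Measurable fun q : (ι → W) × (ι → W) => (q.2, q.1, z))
  refine ⟨fun x => ∫⁻ y, sampleSum κ A (fun w => sampleSum κ B (fun w => f w ^ p) y w) x z ^ (1 / p)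
      ∂(Measure.pi fun _ => P), Measurable.lintegral_prod_right (hm.pow_const _),
      lintegral_lintegral_sampleSum hAB hf z, fun g hg x => ?_⟩
  have e : (fun w => sampledNorm P κ p B f w * g w) = fun w =>
      ∫⁻ y, sampleSum κ B (fun w => f w ^ p) y w ^ (1 / p) * g w ∂(Measure.pi fun _ => P) := by
    ext w
    exact (lintegral_mul_const _ ((measurable_sampleSum κ B (hf.pow_const p) measurable_id
      measurable_const).pow_const _)).symm
  rw [e, sampleSum, ← lintegral_lmarginal_swap (Measure.pi fun _ => P) (fun k => κ (x k)) A
    (H := fun y w => sampleSum κ B (fun w => f w ^ p) y w ^ (1 / p) * g w)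
    ((hB.pow_const _).mul (hg.comp measurable_snd))]
  refine le_trans (lintegral_mono fun y => ?_) (lintegral_mul_const (sampleSum κ A g x z)
    ((hm.comp (measurable_const (a := x).prodMk measurable_id)).pow_const (1 / p))).le
  exact lmarginal_rpow_mul_le (fun k => hS.le_lintegral (x k)) A
    (hB.comp (measurable_const.prodMk measurable_id)) hg (by positivity) z

variable [IsFiniteMeasure ν]

theorem IsSampling.lmarginal_sampledNorm_le (hS : IsSampling P κ ν R) (hp : 1 ≤ p)
    {A B : Finset ι} (hAB : Disjoint A B) (hf : Measurable f) (z : ι → S) :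
    (∫⋯∫⁻_A, sampledNorm P κ p B f ∂fun _ => ν) z ≤
      R ^ A.card * sampledNorm P κ p (A ∪ B) f z := by
  obtain ⟨U, hU, hUi, hle⟩ := hS.exists_dominating hp hAB hf z
  rw [← hS.lintegral_sampleSum A (measurable_sampledNorm p B hf) z, ← hUi,
    ← lintegral_const_mul _ hU]
  refine lintegral_mono fun x => ?_
  have := hle (fun _ => 1) measurable_const x
  simp only [mul_one] at this
  refine this.trans ?_
  rw [mul_comm]
  gcongr
  exact hS.sampleSum_one_le A (fun _ => le_rfl) x z

/-- Markov's inequality, in a form which also holds for `T = 0` and `T = ∞`. -/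
theorem measure_tail_le {X : Type*} [MeasurableSpace X] {Q : Measure X} {U : X → ℝ≥0∞}
    (hU : Measurable U) {T : ℝ≥0∞} (hT : ∫⁻ x, U x ∂Q ≤ T) : Q {x | 16 * T < U x} ≤ 1 / 16 := by
  rcases eq_or_ne T 0 with rfl | hT0
  · have h0 := (lintegral_eq_zero_iff hU).1 (le_antisymm hT zero_le)
    have : Q {x | 16 * 0 < U x} = 0 := by
      rw [mul_zero]
      exact measure_mono_null (fun x (hx : 0 < U x) => hx.ne') (ae_iff.1 h0)
    rw [this]
    exact zero_le
  rcases eq_or_ne T ∞ with rfl | hTt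
  · simp
  have h1 := (mul_meas_ge_le_lintegral (μ := Q) hU (16 * T)).trans hT
  have h2 : Q {x | 16 * T < U x} ≤ Q {x | 16 * T ≤ U x} :=
    measure_mono fun x (hx : 16 * T < U x) => hx.le
  refine h2.trans ?_
  rw [ENNReal.le_div_iff_mul_le (by simp) (by simp)]
  rw [← ENNReal.mul_le_mul_iff_right hT0 hTt]
  refine le_trans (le_of_eq ?_) (h1.trans (mul_one T).ge)
  ring

/-- On a set where the norm in the variables `J` dominates the norms in more variables, this norm
is integrable in the remaining variables, with a bound that does not depend on the number of
points. By Markov's inequality few points of `E` are sampled, whatever variables are frozen, so the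
sections of `E` have bounded measure. The sum of the norms over the sampled points of `E` is at most
the number of these points times the dominating function of `exists_dominating`; where this number
is not bounded, the second moment bound takes over. -/
theorem IsSampling.lmarginal_indicator_le (hS : IsSampling P κ ν R) (hp : 1 ≤ p)
    {A J : Finset ι} (hAJ : Disjoint A J) (hf : Measurable f) {E : Set (ι → S)}
    (hE : MeasurableSet E)
    (hpos : ∀ w ∈ E, sampledNorm P κ p J f w ≠ 0) (htop : ∀ w ∈ E, sampledNorm P κ p J f w ≠ ∞)
    (hdom : ∀ w ∈ E, ∀ A' ⊆ A,
      16 ^ A'.card * sampledNorm P κ p (A' ∪ J) f w ≤ sampledNorm P κ p J f w)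
    (z : ι → S) (hfin : sampledNorm P κ p (A ∪ J) f z ≠ ∞) :
    (∫⋯∫⁻_A, (fun w => sampledNorm P κ p J f w * E.indicator 1 w) ∂fun _ => ν) z ≤
      4 * (2 ^ A.card * 2 ^ A.card ^ 2) * sampledNorm P κ p (A ∪ J) f z := by
  have hE1 : Measurable (E.indicator 1 : (ι → S) → ℝ≥0∞) := measurable_one.indicator hE
  have hEle : ∀ w, (E.indicator 1 : (ι → S) → ℝ≥0∞) w ≤ 1 := fun w =>
    Set.indicator_le_self' (by simp) w
  have hN := measurable_sampledNorm (P := P) (κ := κ) p J hf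
  have htail : ∀ A' ⊆ A, ∀ z' : ι → S,
      (Measure.pi fun _ => P) {x | 1 < sampleSum κ A' (E.indicator 1) x z'} ≤ 1 / 16 := by
    intro A' hA' z'
    rcases A'.eq_empty_or_nonempty with rfl | hne
    · simp only [sampleSum, lmarginal_empty, (hEle z').not_gt, Set.ofPred_false, measure_empty]
      exact zero_le
    obtain ⟨U, hU, hUi, hle⟩ := hS.exists_dominating hp (hAJ.mono_left hA') hf z'
    -- On `E` the norm in the variables `J` is at least `t`, and neither `0` nor `∞`, so that
    -- `t⁻¹` times this norm is at least `1` even if `t = 0`.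
    set t : (ι → S) → ℝ≥0∞ := fun w => 16 ^ A'.card * sampledNorm P κ p (A' ∪ J) f w with ht
    have hbound : ∀ x, 1 < sampleSum κ A' (E.indicator 1) x z' → 1 ≤ (t z')⁻¹ * U x := by
      intro x hx
      set V := sampleSum κ A' (E.indicator 1) x z' with hV
      have hVtop : V ≠ ∞ :=
        ne_top_of_le_ne_top (by finiteness) (hS.sampleSum_one_le A' hEle x z')
      have h1 : V ≤ (t z')⁻¹ *
          sampleSum κ A' (fun w => sampledNorm P κ p J f w * E.indicator 1 w) x z' := by
        rw [sampleSum, ← lmarginal_mul_of_congr (fun k => κ (x k)) A'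
          (f := fun w => sampledNorm P κ p J f w * E.indicator 1 w) (hN.mul hE1)
          (g := fun w => (t w)⁻¹)]
        · refine lmarginal_mono (fun w => ?_) z'
          by_cases hw : w ∈ E
          · simp only [Set.indicator_of_mem hw, Pi.one_apply, mul_one]
            rw [mul_comm, ← div_eq_mul_inv,
              ENNReal.le_div_iff_mul_le (Or.inr (hpos w hw)) (Or.inr (htop w hw)), one_mul]
            exact hdom w hw A' hA'
          · simp [hw]
        · intro w w' hww
          simp only [ht]
          rw [sampledNorm_congr fun k hk => hww k fun h => hk (Finset.mem_union_left _ h)]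
      have h2 : V ≤ (t z')⁻¹ * U x * V := by
        rw [mul_assoc]
        exact h1.trans (mul_le_mul_right (hle _ hE1 x) _)
      by_contra! hlt
      exact h2.not_gt (by
        simpa using ENNReal.mul_lt_mul_left (zero_lt_one.trans hx).ne' hVtop hlt)
    refine (measure_mono hbound).trans ?_
    have h3 := mul_meas_ge_le_lintegral (μ := Measure.pi fun _ => P) (hU.const_mul (t z')⁻¹) 1
    rw [one_mul, lintegral_const_mul _ hU, hUi] at h3
    refine h3.trans ?_
    simp only [ht]
    rw [ENNReal.mul_inv (by simp) (by simp), mul_assoc]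
    calc _ ≤ ((16 : ℝ≥0∞) ^ A'.card)⁻¹ * 1 := by
          gcongr
          exact ENNReal.inv_mul_le_one _
      _ ≤ 1 / 16 := by
          rw [mul_one, one_div, ENNReal.inv_le_inv]
          calc (16 : ℝ≥0∞) = 16 ^ 1 := (pow_one _).symm
            _ ≤ _ := by
              gcongr
              · norm_num
              · exact hne.card_pos
  set c0 : ℝ≥0∞ := 2 ^ A.card ^ 2 with hc0
  set c : ℝ≥0∞ := 2 ^ A.card * c0 with hc
  have hsec : ∀ A' ⊆ A, ∀ z' : ι → S, (∫⋯∫⁻_A', E.indicator 1 ∂fun _ => ν) z' ≤ c0 := by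
    intro A' hA' z'
    refine (hS.lmarginal_le_of_tail A' hE1 z' 1 fun B hB z'' _ =>
      htail B (hB.trans hA') z'').trans ?_
    rw [mul_one, hc0]
    gcongr
    norm_num
  have hfull : ∀ s : ι → S,
      (∫⋯∫⁻_A, E.indicator 1 ∂fun k => ν + Measure.dirac (s k)) z ≤ c := by
    intro s
    refine (lmarginal_add_dirac_le ν s c0 A hE1 z fun A' hA' z' _ => hsec A' hA'.subset z').trans ?_
    refine (add_le_add_left (hsec A subset_rfl z) _).trans (le_of_eq ?_)
    obtain ⟨n, hn⟩ : ∃ n, 2 ^ A.card = n + 1 := Nat.exists_eq_succ_of_ne_zero (by positivity)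
    have hn' : (2 : ℝ≥0∞) ^ A.card = n + 1 := by exact_mod_cast hn
    rw [hc, hn', hn, Nat.add_sub_cancel]
    ring
  have hG : Measurable fun w => sampledNorm P κ p J f w * E.indicator 1 w := hN.mul hE1
  have hGm := hS.lintegral_sampleSum_mul_le A hG hE1 z z c hfull
  set M := (∫⋯∫⁻_A, (fun w => sampledNorm P κ p J f w * E.indicator 1 w) ∂fun _ => ν) z with hM
  -- A crude bound depending on `R`, needed to absorb `M` below.
  have hMtop : M ≠ ∞ := by
    refine ne_top_of_le_ne_top ?_ ((lmarginal_mono (fun w => ?_) z).trans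
      (hS.lmarginal_sampledNorm_le hp hAJ hf z))
    · finiteness
    · calc _ ≤ sampledNorm P κ p J f w * 1 := by gcongr; exact hEle w
        _ = _ := mul_one _
  obtain ⟨U, hU, hUi, hle⟩ := hS.exists_dominating hp hAJ hf z
  have hc1 : c ≠ 0 := by simp [hc, hc0]
  have hct : c ≠ ∞ := by rw [hc, hc0]; finiteness
  have hint : 2 * c * M ≤ 4 * c * c * sampledNorm P κ p (A ∪ J) f z + M * c := by
    rw [hM, ← hS.lintegral_sampleSum A hG z, ← hUi]
    rw [← lintegral_const_mul _ (f := fun x => sampleSum κ A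
        (fun w => sampledNorm P κ p J f w * E.indicator 1 w) x z)
        (measurable_sampleSum κ A hG measurable_id measurable_const), ← lintegral_const_mul _ hU]
    refine le_trans ?_ (add_le_add_right (hGm.trans_eq ?_) _)
    · rw [← lintegral_add_left (hU.const_mul _)]
      refine lintegral_mono fun x => ?_
      -- Either at most `2 * c` points of `E` are sampled, or their number divided by `2 * c` is a
      -- factor that is at least `1`.
      rcases le_total (sampleSum κ A (E.indicator 1) x z) (2 * c) with h | h
      · refine le_trans ?_ le_self_add
        calc _ ≤ 2 * c * (U x * (2 * c)) := by
              gcongr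
              exact (hle _ hE1 x).trans (by gcongr)
          _ = _ := by ring
      · refine le_trans ?_ le_add_self
        rw [mul_comm]
        gcongr
    · rw [hS.lintegral_sampleSum A hG z]
  have h4 : c * M ≤ c * (4 * c * sampledNorm P κ p (A ∪ J) f z) := by
    have : c * M + M * c ≤ c * (4 * c * sampledNorm P κ p (A ∪ J) f z) + M * c := by
      refine (le_of_eq (by ring)).trans (hint.trans (le_of_eq (by ring)))
    exact (ENNReal.add_le_add_iff_right (by finiteness)).1 this
  exact (ENNReal.mul_le_mul_iff_right hc1 hct).1 h4

end SampledNorm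

/-! ### The decomposition and the comparison of norms -/

section Decomposition

variable {ι S W : Type*} [Fintype ι] [DecidableEq ι] [MeasurableSpace S] [MeasurableSpace W]
  {P : Measure W} {κ : Kernel W S}
  {ν : Measure S} {R : ℝ≥0} {p : ℝ} {f : (ι → S) → ℝ≥0∞}

/-- The set where `16 ^ |A| * sampledNorm P κ p A f` is maximal at `A = J`, ties being broken by an
enumeration of the subsets of `ι`, and where the norm in the variables `J` is neither `0` nor
`∞`. -/
def maximalSet (P : Measure W) (κ : Kernel W S) (p : ℝ) (f : (ι → S) → ℝ≥0∞) (J : Finset ι) :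
    Set (ι → S) :=
  {z | sampledNorm P κ p J f z ≠ 0 ∧ sampledNorm P κ p J f z ≠ ∞ ∧ ∀ A : Finset ι,
    16 ^ A.card * sampledNorm P κ p A f z ≤ 16 ^ J.card * sampledNorm P κ p J f z ∧
    (Fintype.equivFin (Finset ι) A < Fintype.equivFin (Finset ι) J →
      16 ^ A.card * sampledNorm P κ p A f z < 16 ^ J.card * sampledNorm P κ p J f z)}

theorem pairwise_disjoint_maximalSet (p : ℝ) (f : (ι → S) → ℝ≥0∞) :
    Pairwise fun J K : Finset ι => Disjoint (maximalSet P κ p f J) (maximalSet P κ p f K) := by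
  intro J K hJK
  rw [Set.disjoint_left]
  intro z hJ hK
  rcases lt_or_gt_of_ne ((Fintype.equivFin (Finset ι)).injective.ne hJK) with h | h
  · exact ((hK.2.2 J).2 h).not_ge (hJ.2.2 K).1
  · exact ((hJ.2.2 K).2 h).not_ge (hK.2.2 J).1

variable [IsProbabilityMeasure P]

theorem exists_mem_maximalSet (hp : 1 ≤ p) {z : ι → S} (hz : f z ≠ 0)
    (hfin : ∀ A, sampledNorm P κ p A f z ≠ ∞) : ∃ J, z ∈ maximalSet P κ p f J := by
  obtain ⟨J₀, -, hJ₀⟩ := Finset.exists_max_image Finset.univ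
    (fun A : Finset ι => 16 ^ A.card * sampledNorm P κ p A f z) Finset.univ_nonempty
  obtain ⟨J, hJ, hJmin⟩ := Finset.exists_min_image
    {A | 16 ^ A.card * sampledNorm P κ p A f z = 16 ^ J₀.card * sampledNorm P κ p J₀ f z}
    (Fintype.equivFin (Finset ι)) ⟨J₀, by simp⟩
  rw [Finset.mem_filter_univ] at hJ
  have hmax : ∀ A : Finset ι, 16 ^ A.card * sampledNorm P κ p A f z ≤
      16 ^ J.card * sampledNorm P κ p J f z := fun A => by
    rw [hJ]
    exact hJ₀ A (Finset.mem_univ A)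
  refine ⟨J, fun h => hz ?_, hfin J, fun A => ⟨hmax A, fun hlt => lt_of_le_of_ne (hmax A) fun h => ?_⟩⟩
  · have := hmax ∅
    rw [h, sampledNorm_empty hp] at this
    simpa using this
  · exact (hJmin A (by rw [Finset.mem_filter_univ, h, hJ])).not_gt hlt

variable [IsFiniteKernel κ]

theorem measurableSet_maximalSet (p : ℝ) (hf : Measurable f) (J : Finset ι) :
    MeasurableSet (maximalSet P κ p f J) := by
  have hm : ∀ A : Finset ι, Measurable (sampledNorm P κ p A f) := fun A =>
    measurable_sampledNorm p A hf
  have hm' : ∀ A : Finset ι, Measurable fun z => 16 ^ A.card * sampledNorm P κ p A f z := fun A =>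
    (hm A).const_mul _
  have e : maximalSet P κ p f J = sampledNorm P κ p J f ⁻¹' {0}ᶜ ∩
      (sampledNorm P κ p J f ⁻¹' {∞}ᶜ ∩ ⋂ A : Finset ι,
        ({z | 16 ^ A.card * sampledNorm P κ p A f z ≤ 16 ^ J.card * sampledNorm P κ p J f z} ∩
          {z | Fintype.equivFin (Finset ι) A < Fintype.equivFin (Finset ι) J →
            16 ^ A.card * sampledNorm P κ p A f z < 16 ^ J.card * sampledNorm P κ p J f z})) := by
    ext z
    simp [maximalSet]
  rw [e]
  refine ((hm J) (measurableSet_singleton 0).compl).inter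
    (((hm J) (measurableSet_singleton ∞).compl).inter ?_)
  refine MeasurableSet.iInter fun A => (measurableSet_le (hm' A) (hm' J)).inter ?_
  by_cases h : Fintype.equivFin (Finset ι) A < Fintype.equivFin (Finset ι) J
  · simpa only [h, true_imp_iff] using measurableSet_lt (hm' A) (hm' J)
  · simp [h]

/-- Where the norms in fewer variables than `J` are dominated by the norm in the variables `J`, the
latter controls the full `Lᵖ` norm in the variables `J`. -/
theorem IsSampling.lmarginal_rpow_indicator_le [IsFiniteMeasure ν] (hS : IsSampling P κ ν R)
    (hp : 1 ≤ p) (J : Finset ι) (hf : Measurable f) {E : Set (ι → S)} (hE : MeasurableSet E)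
    (hdom : ∀ w ∈ E, ∀ A ⊆ J,
      16 ^ A.card * sampledNorm P κ p A f w ≤ 16 ^ J.card * sampledNorm P κ p J f w)
    (z : ι → S) :
    (∫⋯∫⁻_J, (fun w => E.indicator f w ^ p) ∂fun _ => ν) z ≤
      2 ^ J.card ^ 2 * (16 * (16 ^ J.card * sampledNorm P κ p J f z)) ^ p := by
  have hp0 : 0 < p := zero_lt_one.trans_le hp
  refine hS.lmarginal_le_of_tail J ((hf.indicator hE).pow_const p) z _ fun A hA z' hz' => ?_
  set T := 16 ^ J.card * sampledNorm P κ p J f z with hT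
  by_cases hAT : sampledNorm P κ p A f z' ≤ T
  · refine (measure_mono fun x (hx : _ < sampleSum κ A _ x z') => ?_).trans (measure_tail_le
      ((measurable_sampleSum κ A (hf.pow_const p) measurable_id measurable_const).pow_const _) hAT)
    change 16 * T < sampleSum κ A (fun w => f w ^ p) x z' ^ (1 / p)
    rw [one_div, ENNReal.lt_rpow_inv_iff hp0]
    refine hx.trans_le (lmarginal_mono (fun w => ?_) z')
    dsimp only
    gcongr
    exact Set.indicator_le_self' (by simp) w
  · -- No point that agrees with `z'` outside `A` lies in `E`.
    have h0 : ∀ x, sampleSum κ A (fun w => E.indicator f w ^ p) x z' = 0 := fun x => by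
      rw [sampleSum, lmarginal, ← lintegral_zero]
      refine lintegral_congr fun y => ?_
      have hw : updateFinset z' A y ∉ E := fun hw => hAT <| by
        have h1 := hdom _ hw A hA
        rw [sampledNorm_congr (z' := z') fun k hk => by simp [updateFinset, hk],
          sampledNorm_congr (A := J) (z' := z) fun k hk => by
            rw [updateFinset, dif_neg fun h => hk (hA h), hz' k hk]] at h1
        refine le_trans ?_ h1
        exact le_mul_of_one_le_left zero_le (one_le_pow₀ (by norm_num))
      rw [Set.indicator_of_notMem hw, ENNReal.zero_rpow_of_pos hp0]
    simp [h0]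

theorem IsSampling.ae_sampledNorm_ne_top [IsFiniteMeasure ν] (hS : IsSampling P κ ν R)
    (hp : 1 ≤ p) (hf : Measurable f) (hfin : ∀ z, sampledNorm P κ p Finset.univ f z ≠ ∞) :
    ∀ᵐ z ∂(Measure.pi fun _ : ι => ν), ∀ A, sampledNorm P κ p A f z ≠ ∞ := by
  rw [ae_all_iff]
  intro A
  have hm := measurable_sampledNorm (P := P) (κ := κ) p A hf
  refine (ae_lt_top hm ?_).mono fun z hz => hz.ne
  rcases isEmpty_or_nonempty (ι → S) with h | ⟨⟨z⟩⟩
  · simp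
  rw [lintegral_eq_lmarginal_univ z, ← Finset.union_compl A,
    lmarginal_union _ _ hm disjoint_compl_right]
  refine ne_top_of_le_ne_top ?_ (lintegral_mono
    (g := fun _ => (R : ℝ≥0∞) ^ Aᶜ.card * sampledNorm P κ p Finset.univ f z) fun y => ?_)
  · rw [lintegral_const]
    have := hfin z
    finiteness
  · refine (hS.lmarginal_sampledNorm_le hp disjoint_compl_left hf _).trans (le_of_eq ?_)
    rw [Finset.union_comm, Finset.union_compl, sampledNorm_congr (z' := z) (by simp)]

/-- The function restricted to the set where `J` is the maximal index is controlled in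
`L¹(S^{J'}, Lᵖ(S^J))`. -/
theorem IsSampling.lmarginal_maximalSet_le [IsFiniteMeasure ν] (hS : IsSampling P κ ν R)
    (hp : 1 ≤ p) (hf : Measurable f) (hfin : ∀ z, sampledNorm P κ p Finset.univ f z ≠ ∞)
    (J : Finset ι) (z : ι → S) :
    (∫⋯∫⁻_Jᶜ, (fun w => (∫⋯∫⁻_J, (fun w => (maximalSet P κ p f J).indicator f w ^ p)
        ∂fun _ => ν) w ^ (1 / p)) ∂fun _ => ν) z ≤
      2 ^ Fintype.card ι ^ 2 * 16 ^ (Fintype.card ι + 1) *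
        (4 * (2 ^ Fintype.card ι * 2 ^ Fintype.card ι ^ 2)) *
        sampledNorm P κ p Finset.univ f z := by
  have hp0 : 0 < p := zero_lt_one.trans_le hp
  set d := Fintype.card ι with hd
  have hJd : J.card ≤ d := Finset.card_le_univ J
  have hJd' : Jᶜ.card ≤ d := Finset.card_le_univ Jᶜ
  have hm : ∀ A : Finset ι, Measurable (sampledNorm P κ p A f) := fun A =>
    measurable_sampledNorm p A hf
  have hE := measurableSet_maximalSet (P := P) (κ := κ) p hf J
  -- The part of the conditions defining the maximal set that involves only variables outside `J`.
  set E : Set (ι → S) := {w | sampledNorm P κ p J f w ≠ 0 ∧ sampledNorm P κ p J f w ≠ ∞ ∧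
    ∀ A : Finset ι, A ⊆ Jᶜ →
      16 ^ A.card * sampledNorm P κ p (A ∪ J) f w ≤ sampledNorm P κ p J f w} with hEdef
  have hEm : MeasurableSet E := by
    have e : E = sampledNorm P κ p J f ⁻¹' {0}ᶜ ∩ (sampledNorm P κ p J f ⁻¹' {∞}ᶜ ∩
        ⋂ (A : Finset ι) (_ : A ⊆ Jᶜ),
          {w | 16 ^ A.card * sampledNorm P κ p (A ∪ J) f w ≤ sampledNorm P κ p J f w}) := by
      ext w
      simp [hEdef]
    rw [e]
    refine ((hm J) (measurableSet_singleton 0).compl).inter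
      (((hm J) (measurableSet_singleton ∞).compl).inter ?_)
    exact MeasurableSet.iInter fun A => MeasurableSet.iInter fun _ =>
      measurableSet_le ((hm _).const_mul _) (hm J)
  have hsub : maximalSet P κ p f J ⊆ E := fun w hw => ⟨hw.1, hw.2.1, fun A hA => by
    have h := (hw.2.2 (A ∪ J)).1
    have hAJ : Disjoint A J := Finset.disjoint_left.2 fun k hk => Finset.mem_compl.1 (hA hk)
    rw [Finset.card_union_of_disjoint hAJ, add_comm, pow_add, mul_assoc] at h
    exact (ENNReal.mul_le_mul_iff_right (by simp) (by simp)).1 h⟩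
  have hinner : ∀ w, (∫⋯∫⁻_J, (fun w => (maximalSet P κ p f J).indicator f w ^ p)
      ∂fun _ => ν) w ^ (1 / p) ≤ 2 ^ d ^ 2 * 16 ^ (d + 1) *
        (sampledNorm P κ p J f w * E.indicator 1 w) := fun w => by
    by_cases hw : w ∈ E
    · rw [Set.indicator_of_mem hw, Pi.one_apply, mul_one, one_div, ENNReal.rpow_inv_le_iff hp0]
      refine (hS.lmarginal_rpow_indicator_le hp J hf hE
        (fun w hw A _ => (hw.2.2 A).1) w).trans ?_
      rw [mul_assoc (2 ^ d ^ 2), ENNReal.mul_rpow_of_nonneg (2 ^ d ^ 2) _ hp0.le]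
      refine mul_le_mul' ?_ ?_
      · calc (2 : ℝ≥0∞) ^ J.card ^ 2 ≤ 2 ^ d ^ 2 := by
              gcongr
              norm_num
          _ ≤ (2 ^ d ^ 2) ^ p := ENNReal.le_rpow_self_of_one_le (one_le_pow₀ (by norm_num)) hp
      · rw [← mul_assoc, ← pow_succ']
        gcongr
        norm_num
    · have h0 : (∫⋯∫⁻_J, (fun w => (maximalSet P κ p f J).indicator f w ^ p)
          ∂fun _ => ν) w = 0 := by
        rw [lmarginal, ← lintegral_zero]
        refine lintegral_congr fun y => ?_
        have hw' : updateFinset w J y ∉ maximalSet P κ p f J := fun h => hw <| by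
          have h2 := hsub h
          have hJ := sampledNorm_congr (P := P) (κ := κ) (p := p) (f := f) (A := J) (z' := w)
            (z := updateFinset w J y) fun k hk => by simp [updateFinset, hk]
          have hAJ := fun A => sampledNorm_congr (P := P) (κ := κ) (p := p) (f := f) (A := A ∪ J)
            (z' := w) (z := updateFinset w J y) fun k hk => by
              rw [updateFinset, dif_neg fun h => hk (Finset.mem_union_right _ h)]
          simpa only [hEdef, Set.mem_ofPred_eq, hJ, hAJ] using h2
        rw [Set.indicator_of_notMem hw', ENNReal.zero_rpow_of_pos hp0]
      rw [h0, ENNReal.zero_rpow_of_pos (by positivity)]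
      exact zero_le
  refine (lmarginal_mono hinner z).trans ?_
  rw [lmarginal_const_mul (fun _ => ν) Jᶜ (2 ^ d ^ 2 * 16 ^ (d + 1))
    (f := fun w => sampledNorm P κ p J f w * E.indicator 1 w)
    ((hm J).mul (measurable_one.indicator hEm)), mul_assoc (_ * _)]
  gcongr
  have h := hS.lmarginal_indicator_le hp (disjoint_compl_left (a := J)) hf hEm
    (fun w hw => hw.1) (fun w hw => hw.2.1) (fun w hw => hw.2.2) z
    (by rw [Finset.union_comm, Finset.union_compl]; exact hfin z)
  rw [Finset.union_comm, Finset.union_compl] at h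
  refine h.trans ?_
  gcongr <;> norm_num

/-- Jensen's inequality for the concave function `t ↦ t ^ q`. -/
theorem lintegral_rpow_le_rpow_lintegral {X : Type*} [MeasurableSpace X] (Q : Measure X)
    [IsProbabilityMeasure Q] {F : X → ℝ≥0∞} (hF : Measurable F) {q : ℝ} (hq : 0 < q)
    (hq1 : q ≤ 1) : ∫⁻ x, F x ^ q ∂Q ≤ (∫⁻ x, F x ∂Q) ^ q := by
  have h := eLpNorm'_le_eLpNorm'_of_exponent_le hq hq1 Q hF.aestronglyMeasurable
  simp only [eLpNorm', enorm_eq_self, ENNReal.rpow_one, div_one, one_div] at h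
  rwa [ENNReal.rpow_inv_le_iff hq] at h

/-- The sampled norm is dominated by the norm of `L¹(S^{J'}, Lᵖ(S^J))`, for every `J`. -/
theorem IsSampling.sampledNorm_univ_le [IsFiniteMeasure ν] (hS : IsSampling P κ ν R)
    (hp : 1 ≤ p) (hf : Measurable f) (J : Finset ι) (z : ι → S) :
    sampledNorm P κ p Finset.univ f z ≤
      (∫⋯∫⁻_Jᶜ, (fun w => (∫⋯∫⁻_J, (fun w => f w ^ p) ∂fun _ => ν) w ^ (1 / p)) ∂fun _ => ν) z := by
  have hq : 0 < 1 / p := one_div_pos.2 (zero_lt_one.trans_le hp)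
  have hq1 : 1 / p ≤ 1 := (div_le_one (zero_lt_one.trans_le hp)).2 hp
  have hB := measurable_sampleSum κ J (hf.pow_const p) (measurable_fst (α := ι → W) (β := ι → S))
    measurable_snd
  have hN := measurable_sampledNorm (P := P) (κ := κ) p J hf
  calc sampledNorm P κ p Finset.univ f z
      = ∫⁻ x, ∫⁻ y, sampleSum κ Jᶜ (fun w => sampleSum κ J (fun w => f w ^ p) y w) x z ^ (1 / p)
          ∂(Measure.pi fun _ => P) ∂(Measure.pi fun _ => P) := by
        rw [lintegral_lintegral_sampleSum disjoint_compl_left hf z, Finset.union_comm,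
          Finset.union_compl]
    _ ≤ ∫⁻ x, ∫⁻ y, sampleSum κ Jᶜ (fun w => sampleSum κ J (fun w => f w ^ p) y w ^ (1 / p)) x z
          ∂(Measure.pi fun _ => P) ∂(Measure.pi fun _ => P) :=
        lintegral_mono fun x => lintegral_mono fun y =>
          rpow_lmarginal_le (fun k => hS.le_lintegral (x k)) Jᶜ
            (hB.comp (measurable_const.prodMk measurable_id)) hq hq1 z
    _ = ∫⁻ x, sampleSum κ Jᶜ (sampledNorm P κ p J f) x z ∂(Measure.pi fun _ => P) :=
        lintegral_congr fun x => lintegral_lmarginal_swap (Measure.pi fun _ => P)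
          (fun k => κ (x k)) Jᶜ (H := fun y w => sampleSum κ J (fun w => f w ^ p) y w ^ (1 / p))
          (hB.pow_const _) z
    _ = (∫⋯∫⁻_Jᶜ, sampledNorm P κ p J f ∂fun _ => ν) z := hS.lintegral_sampleSum Jᶜ hN z
    _ ≤ _ := by
        refine lmarginal_mono (fun w => ?_) z
        dsimp only
        rw [← hS.lintegral_sampleSum J (hf.pow_const p) w]
        exact lintegral_rpow_le_rpow_lintegral _
          (measurable_sampleSum κ J (hf.pow_const p) measurable_id measurable_const) hq hq1

end Decomposition

/-! ### The triangle inequality -/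

section Minkowski

variable {ι S W : Type*} [Fintype ι] [DecidableEq ι] [MeasurableSpace S] [MeasurableSpace W]
  {P : Measure W} {κ : Kernel W S} {p : ℝ}

theorem sampledNorm_mono (hp : 1 ≤ p) {A : Finset ι} {f g : (ι → S) → ℝ≥0∞} (hfg : f ≤ g)
    (z : ι → S) : sampledNorm P κ p A f z ≤ sampledNorm P κ p A g z := by
  refine lintegral_mono fun x => ?_
  have hp0 : 0 < p := zero_lt_one.trans_le hp
  dsimp only
  gcongr
  refine lmarginal_mono (fun w => ?_) z
  dsimp only
  gcongr
  exact hfg w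

variable [IsFiniteKernel κ]

theorem sampledNorm_add_le (hp : 1 ≤ p) (A : Finset ι) {f g : (ι → S) → ℝ≥0∞} (hf : Measurable f)
    (hg : Measurable g) (z : ι → S) :
    sampledNorm P κ p A (fun w => f w + g w) z ≤
      sampledNorm P κ p A f z + sampledNorm P κ p A g z := by
  unfold sampledNorm
  rw [← lintegral_add_left (f := fun x => sampleSum κ A (fun w => f w ^ p) x z ^ (1 / p))
    ((measurable_sampleSum κ A (hf.pow_const p) measurable_id measurable_const).pow_const _)]
  refine lintegral_mono fun x => ?_
  exact ENNReal.lintegral_Lp_add_le (hf.comp measurable_updateFinset).aemeasurable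
    (hg.comp measurable_updateFinset).aemeasurable hp

theorem sampledNorm_sum_le (hp : 1 ≤ p) (A : Finset ι) {K : Type*} (s : Finset K)
    {f : K → (ι → S) → ℝ≥0∞} (hf : ∀ J, Measurable (f J)) (z : ι → S) :
    sampledNorm P κ p A (fun w => ∑ J ∈ s, f J w) z ≤ ∑ J ∈ s, sampledNorm P κ p A (f J) z := by
  classical
  induction s using Finset.induction with
  | empty =>
    have hp0 : 0 < p := zero_lt_one.trans_le hp
    simp [sampledNorm, sampleSum, lmarginal, hp0]
  | insert J s hJ ih =>
    simp only [Finset.sum_insert hJ]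
    refine (sampledNorm_add_le hp A (hf J) (Finset.measurable_sum _ fun J _ => hf J) z).trans ?_
    gcongr

end Minkowski

/-! ### Sampling one point from each copy -/

section Copies

variable {n : ℕ} {Ω : Type*} [MeasurableSpace Ω]

/-- The kernel which sends `w ∈ Ωⁿ` to the sum of the point masses at the points `w i` of the
`i`-th copy of `Ω`. -/
noncomputable def copiesKernel (n : ℕ) (Ω : Type*) [MeasurableSpace Ω] :
    Kernel (Fin n → Ω) (Copies n Ω) where
  toFun w := ∑ i, Measure.dirac (i, w i)
  measurable' := by
    refine Measure.measurable_of_measurable_coe _ fun s hs => ?_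
    simp only [Measure.finsetSum_apply, Measure.dirac_apply' _ hs]
    refine Finset.measurable_sum _ fun i _ => (measurable_one.indicator hs).comp ?_
    exact measurable_const.prodMk (measurable_pi_apply i)

theorem copiesKernel_apply (w : Fin n → Ω) :
    copiesKernel n Ω w = ∑ i, Measure.dirac (i, w i) := rfl

theorem copiesKernel_univ (w : Fin n → Ω) : copiesKernel n Ω w Set.univ = n := by
  simp [copiesKernel_apply, Measure.finsetSum_apply]

instance : IsFiniteKernel (copiesKernel n Ω) :=
  ⟨⟨n, ENNReal.natCast_lt_top n, fun w => (copiesKernel_univ w).le⟩⟩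

theorem lintegral_copiesKernel {φ : Copies n Ω → ℝ≥0∞} (hφ : Measurable φ) (w : Fin n → Ω) :
    ∫⁻ a, φ a ∂copiesKernel n Ω w = ∑ i, φ (i, w i) := by
  rw [copiesKernel_apply, lintegral_finsetSum_measure]
  exact Finset.sum_congr rfl fun i _ => lintegral_dirac' _ hφ

variable (μ : Measure Ω) [IsProbabilityMeasure μ]

theorem lintegral_copiesMeasure {φ : Copies n Ω → ℝ≥0∞} (hφ : Measurable φ) :
    ∫⁻ a, φ a ∂copiesMeasure n μ = ∑ i, ∫⁻ ω, φ (i, ω) ∂μ := by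
  rw [lintegral_prod _ hφ.aemeasurable, lintegral_count, tsum_fintype]

theorem isSampling_copies :
    IsSampling (Measure.pi fun _ : Fin n => μ) (copiesKernel n Ω) (copiesMeasure n μ) n where
  intensity φ hφ := by
    have hm : ∀ i : Fin n, Measurable fun ω => φ (i, ω) := fun i => hφ.comp measurable_prodMk_left
    simp_rw [lintegral_copiesKernel hφ]
    rw [lintegral_copiesMeasure μ hφ, lintegral_finsetSum
      (f := fun i (w : Fin n → Ω) => φ (i, w i)) _ fun i _ => (hm i).comp (measurable_pi_apply i)]
    exact Finset.sum_congr rfl fun i _ =>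
      (measurePreserving_eval (fun _ : Fin n => μ) i).lintegral_comp (hm i)
  pair Φ hΦ := by
    have h1 : ∀ a, Measurable (Φ a) := fun a => hΦ.comp measurable_prodMk_left
    have h2 : ∀ i j : Fin n, Measurable fun q : Ω × Ω => Φ (i, q.1) (j, q.2) := fun i j =>
      hΦ.comp ((measurable_const.prodMk measurable_fst).prodMk
        (measurable_const.prodMk measurable_snd))
    have h3 : ∀ i j : Fin n, Measurable fun w : Fin n → Ω => Φ (i, w i) (j, w j) := fun i j =>
      (h2 i j).comp (f := fun w : Fin n → Ω => (w i, w j))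
        ((measurable_pi_apply i).prodMk (measurable_pi_apply j))
    have hd : Measurable fun a => Φ a a := hΦ.comp (measurable_id.prodMk measurable_id)
    have hν : Measurable fun a => ∫⁻ b, Φ a b ∂copiesMeasure n μ :=
      Measurable.lintegral_prod_right hΦ
    -- Points in different copies are independent; each copy contains one point only.
    have e : ∀ i j : Fin n, i ≠ j → ∫⁻ w, Φ (i, w i) (j, w j) ∂(Measure.pi fun _ : Fin n => μ) =
        ∫⁻ a, ∫⁻ b, Φ (i, a) (j, b) ∂μ ∂μ := fun i j hij => by
      rw [← lintegral_pi_resample μ j (h3 i j)]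
      simp only [update_self, update_of_ne hij]
      exact (measurePreserving_eval (fun _ : Fin n => μ) i).lintegral_comp
        (f := fun a => ∫⁻ b, Φ (i, a) (j, b) ∂μ) (Measurable.lintegral_prod_right (h2 i j))
    have e' : ∀ i : Fin n, ∫⁻ w, Φ (i, w i) (i, w i) ∂(Measure.pi fun _ : Fin n => μ) =
        ∫⁻ a, Φ (i, a) (i, a) ∂μ := fun i =>
      (measurePreserving_eval (fun _ : Fin n => μ) i).lintegral_comp
        (f := fun a => Φ (i, a) (i, a)) (hd.comp measurable_prodMk_left)
    have hL : ∀ w : Fin n → Ω, ∫⁻ a, ∫⁻ b, Φ a b ∂copiesKernel n Ω w ∂copiesKernel n Ω w =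
        ∑ i, ∑ j, Φ (i, w i) (j, w j) := fun w => by
      rw [lintegral_copiesKernel (Measurable.lintegral_prod_right hΦ)]
      exact Finset.sum_congr rfl fun i _ => lintegral_copiesKernel (h1 _) w
    simp_rw [hL]
    rw [lintegral_finsetSum _ fun i _ => Finset.measurable_sum _ fun j _ => h3 i j]
    have hR : ∀ a : Copies n Ω, ∫⁻ b, Φ a b ∂(copiesMeasure n μ + Measure.dirac a) =
        ∫⁻ b, Φ a b ∂copiesMeasure n μ + Φ a a := fun a => by
      rw [lintegral_add_measure, lintegral_dirac' _ (h1 a)]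
    simp_rw [hR]
    rw [lintegral_add_left hν, lintegral_copiesMeasure μ hν, lintegral_copiesMeasure μ hd,
      ← Finset.sum_add_distrib]
    refine Finset.sum_le_sum fun i _ => ?_
    simp_rw [lintegral_copiesMeasure μ (h1 _)]
    rw [lintegral_finsetSum _ fun j _ => h3 i j, lintegral_finsetSum _ fun j _ =>
      Measurable.lintegral_prod_right (f := fun a b => Φ (i, a) (j, b)) (h2 i j)]
    calc ∑ j, ∫⁻ w, Φ (i, w i) (j, w j) ∂(Measure.pi fun _ : Fin n => μ)
        ≤ ∑ j, (∫⁻ a, ∫⁻ b, Φ (i, a) (j, b) ∂μ ∂μ +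
            if j = i then ∫⁻ a, Φ (i, a) (i, a) ∂μ else 0) := by
          refine Finset.sum_le_sum fun j _ => ?_
          by_cases hij : j = i
          · subst hij
            rw [if_pos rfl, e']
            exact le_add_self
          · rw [e i j (Ne.symm hij)]
            exact le_self_add
      _ = _ := by
          rw [Finset.sum_add_distrib, Finset.sum_ite_eq' Finset.univ i, if_pos (Finset.mem_univ i)]
  le_lintegral w F hF := by
    rw [lintegral_copiesKernel hF, ae_iff]
    have hs : MeasurableSet {a | ¬ F a ≤ ∑ i, F (i, w i)} :=
      (measurableSet_le hF measurable_const).compl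
    rw [copiesKernel_apply, Measure.finsetSum_apply]
    refine Finset.sum_eq_zero fun i _ => ?_
    rw [Measure.dirac_apply' _ hs, Set.indicator_of_notMem]
    simpa using Finset.single_le_sum (f := fun i => F (i, w i)) (fun _ _ => zero_le)
      (Finset.mem_univ i)
  mass w := by simp [copiesKernel_univ]

variable {m : ℕ}

/-- The sampled points of the product are indexed by `Fin m → Fin n`. -/
theorem pi_copiesKernel (x : Fin m → Fin n → Ω) :
    Measure.pi (fun k => copiesKernel n Ω (x k)) =
      ∑ i : Fin m → Fin n, Measure.dirac fun k => (i k, x k (i k)) := by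
  refine Measure.pi_eq fun s hs => ?_
  rw [Measure.finsetSum_apply]
  simp only [copiesKernel_apply, Measure.finsetSum_apply, Measure.dirac_apply' _ (hs _),
    Measure.dirac_apply' _ (MeasurableSet.univ_pi hs)]
  rw [Finset.prod_univ_sum, Fintype.piFinset_univ]
  refine Finset.sum_congr rfl fun i _ => ?_
  by_cases h : ∀ k, (i k, x k (i k)) ∈ s k
  · rw [Set.indicator_of_mem (by simpa using h)]
    simp [Set.indicator_of_mem (h _)]
  · rw [Set.indicator_of_notMem (by simpa using h)]
    push Not at h
    obtain ⟨k, hk⟩ := h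
    exact (Finset.prod_eq_zero (Finset.mem_univ k) (by simp [hk])).symm

theorem sampleSum_copies {h : (Fin m → Copies n Ω) → ℝ≥0∞} (hh : Measurable h)
    (x : Fin m → Fin n → Ω) (z : Fin m → Copies n Ω) :
    sampleSum (copiesKernel n Ω) Finset.univ h x z =
      ∑ i : Fin m → Fin n, h fun k => (i k, x k (i k)) := by
  rw [sampleSum, lmarginal_univ, pi_copiesKernel, lintegral_finsetSum_measure]
  exact Finset.sum_congr rfl fun i _ => lintegral_dirac' _ hh

/-- A property of almost every point of the disjoint union holds at all the sampled points. -/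
theorem ae_forall_sampled {q : (Fin m → Copies n Ω) → Prop}
    (hq : ∀ᵐ z ∂(Measure.pi fun _ => copiesMeasure n μ), q z) :
    ∀ᵐ x ∂(Measure.pi fun _ : Fin m => Measure.pi fun _ : Fin n => μ), ∀ i : Fin m → Fin n,
      q fun k => (i k, x k (i k)) := by
  rcases isEmpty_or_nonempty (Fin m → Copies n Ω) with h | ⟨⟨z⟩⟩
  · exact ae_of_all _ fun x i => isEmptyElim fun k : Fin m => ((i k, x k (i k)) : Copies n Ω)
  set N := toMeasurable (Measure.pi fun _ : Fin m => copiesMeasure n μ) {z | ¬ q z} with hN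
  have hNm : MeasurableSet N := measurableSet_toMeasurable _ _
  have hN0 : (Measure.pi fun _ : Fin m => copiesMeasure n μ) N = 0 := by
    rw [hN, measure_toMeasurable]
    exact hq
  have h1 : Measurable (N.indicator 1 : _ → ℝ≥0∞) := measurable_one.indicator hNm
  have h0 := (isSampling_copies μ).lintegral_sampleSum Finset.univ h1 z
  rw [lmarginal_univ, lintegral_indicator_one hNm, hN0, lintegral_eq_zero_iff
    (f := fun x => sampleSum (copiesKernel n Ω) Finset.univ (N.indicator 1) x z)
    (measurable_sampleSum _ _ h1 measurable_id measurable_const)] at h0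
  filter_upwards [h0] with x hx i
  rw [sampleSum_copies h1, Pi.zero_apply, Finset.sum_eq_zero_iff] at hx
  by_contra hqi
  have := hx i (Finset.mem_univ i)
  rw [Set.indicator_of_mem (subset_toMeasurable _ _ hqi)] at this
  simp at this

theorem decoupledIntegral_eq {𝕜 : Type*} [RCLike 𝕜] (p : ℝ)
    {f : (Fin m → Fin n) → (Fin m → Ω) → 𝕜} {g : (Fin m → Copies n Ω) → 𝕜} (hg : Measurable g)
    (hfg : glue f =ᵐ[Measure.pi fun _ => copiesMeasure n μ] g) (z : Fin m → Copies n Ω) :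
    decoupledIntegral μ p f = sampledNorm (Measure.pi fun _ : Fin n => μ) (copiesKernel n Ω) p
      Finset.univ (fun w => ‖g w‖ₑ) z := by
  refine lintegral_congr_ae ?_
  filter_upwards [ae_forall_sampled μ hfg] with x hx
  rw [sampleSum_copies (hg.enorm.pow_const p)]
  refine congrArg (· ^ (1 / p)) (Finset.sum_congr rfl fun i _ => ?_)
  rw [← hx i]
  rfl

end Copies

/-! ### Mixed norms as marginal integrals -/

section MixedNorm

variable {m : ℕ} {S 𝕜 : Type*} [MeasurableSpace S] [RCLike 𝕜] (ν : Measure S) [SigmaFinite ν]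
  (p : ℝ) (J : Finset (Fin m))

theorem mixedNorm_eq_lmarginal (a : (Fin m → S) → 𝕜) (z : Fin m → S) :
    mixedNorm ν p J a = (∫⋯∫⁻_Jᶜ, (fun w => (∫⋯∫⁻_J, (fun w => ‖a w‖ₑ ^ p) ∂fun _ => ν) w ^ (1 / p))
      ∂fun _ => ν) z := by
  let e : {k : Fin m // k ∉ J} ≃ (Jᶜ : Finset (Fin m)) :=
    Equiv.subtypeEquivRight fun k => Finset.mem_compl.symm
  have h := (measurePreserving_piCongrLeft (fun _ : (Jᶜ : Finset (Fin m)) => ν)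
    e).lintegral_map_equiv fun y =>
      (∫⋯∫⁻_J, (fun w => ‖a w‖ₑ ^ p) ∂fun _ => ν) (updateFinset z Jᶜ y) ^ (1 / p)
  rw [lmarginal, h]
  refine lintegral_congr fun y => ?_
  refine congrArg (· ^ (1 / p)) (lintegral_congr fun x => ?_)
  congr 3
  ext k
  by_cases hk : k ∈ J
  · simp [updateFinset, hk, Equiv.piEquivPiSubtypeProd]
  · have := MeasurableEquiv.piCongrLeft_apply_apply (β := fun _ => S) e y ⟨k, hk⟩
    simp [updateFinset, hk, Equiv.piEquivPiSubtypeProd]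
    exact this.symm

theorem mixedNorm_congr {a b : (Fin m → S) → 𝕜} (h : a =ᵐ[Measure.pi fun _ => ν] b) :
    mixedNorm ν p J a = mixedNorm ν p J b := by
  have hmp := (measurePreserving_piEquivPiSubtypeProd (fun _ : Fin m => ν) (· ∈ J)).symm
  have h1 := (hmp.comp Measure.measurePreserving_swap).quasiMeasurePreserving.ae h
  refine lintegral_congr_ae ?_
  filter_upwards [Measure.ae_ae_of_ae_prod h1] with y hy
  refine congrArg (· ^ (1 / p)) (lintegral_congr_ae ?_)
  have hy' : ∀ᵐ x ∂(Measure.pi fun _ : J => ν),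
      a ((Equiv.piEquivPiSubtypeProd (· ∈ J) fun _ => S).symm (x, y)) =
        b ((Equiv.piEquivPiSubtypeProd (· ∈ J) fun _ => S).symm (x, y)) := by
    -- The two sides use different `Fintype` instances on `{k // k ∈ J}`.
    convert hy using 3 <;> rfl
  filter_upwards [hy'] with x hx
  exact congrArg (fun t => ‖t‖ₑ ^ p) hx

end MixedNorm

/-! ### Measurability of the glued function -/

section Glue

variable {m n : ℕ} {Ω 𝕜 : Type*} [MeasurableSpace Ω] [RCLike 𝕜] (μ : Measure Ω)
  [IsProbabilityMeasure μ]

theorem aestronglyMeasurable_glue {f : (Fin m → Fin n) → (Fin m → Ω) → 𝕜}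
    (hf : ∀ i, AEStronglyMeasurable (f i) (Measure.pi fun _ => μ)) :
    AEStronglyMeasurable (glue f) (Measure.pi fun _ => copiesMeasure n μ) := by
  have hm : Measurable (glue fun i => (hf i).mk (f i)) := by
    refine Measurable.comp (g := fun q : (Fin m → Fin n) × (Fin m → Ω) => (hf q.1).mk (f q.1) q.2)
      (f := fun z : Fin m → Copies n Ω => (fun k => (z k).1, fun k => (z k).2)) ?_ (by fun_prop)
    exact measurable_from_prod_countable_right fun i => (hf i).stronglyMeasurable_mk.measurable
  refine ⟨_, hm.stronglyMeasurable, ?_⟩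
  have h1 : ∀ᵐ x ∂(Measure.pi fun _ : Fin m => μ), ∀ i, f i x = (hf i).mk (f i) x :=
    ae_all_iff.2 fun i => (hf i).ae_eq_mk
  have h2 := (measurePreserving_arrowProdEquivProdArrow (Fin n) Ω (Fin m)
    (fun _ => Measure.count) fun _ => μ)
  have h3 := (Measure.quasiMeasurePreserving_snd.comp h2.quasiMeasurePreserving).ae h1
  filter_upwards [h3] with z hz
  exact hz _

end Glue

/-! ### The two estimates for the interpolation sum -/

section SumNorm

variable {m n : ℕ} {Ω 𝕜 : Type*} [MeasurableSpace Ω] [RCLike 𝕜] (μ : Measure Ω)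
  [IsProbabilityMeasure μ] {p : ℝ} {f : (Fin m → Fin n) → (Fin m → Ω) → 𝕜}

/-- The decoupled integral is at most the norm of any decomposition. -/
theorem decoupledIntegral_le_sum_mixedNorm (hp : 1 ≤ p)
    {a : Finset (Fin m) → (Fin m → Copies n Ω) → 𝕜}
    (ha : IsDecomposition (copiesMeasure n μ) p (glue f) a) (z : Fin m → Copies n Ω) :
    decoupledIntegral μ p f ≤ ∑ J, mixedNorm (copiesMeasure n μ) p J (a J) := by
  set b : Finset (Fin m) → (Fin m → Copies n Ω) → 𝕜 := fun J => (ha.1 J).1.mk (a J) with hb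
  have hbm : ∀ J, Measurable (b J) := fun J => (ha.1 J).1.stronglyMeasurable_mk.measurable
  have hab : ∀ J, a J =ᵐ[Measure.pi fun _ => copiesMeasure n μ] b J := fun J =>
    (ha.1 J).1.ae_eq_mk
  have hfb : glue f =ᵐ[Measure.pi fun _ => copiesMeasure n μ] fun z => ∑ J, b J z := by
    filter_upwards [ha.2, ae_all_iff.2 hab] with z hz hz'
    rw [hz]
    exact Finset.sum_congr rfl fun J _ => hz' J
  rw [decoupledIntegral_eq μ p (Finset.measurable_sum _ fun J _ => hbm J) hfb z]
  calc _ ≤ sampledNorm (Measure.pi fun _ : Fin n => μ) (copiesKernel n Ω) p Finset.univ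
          (fun w => ∑ J, ‖b J w‖ₑ) z := sampledNorm_mono hp (fun w => enorm_sum_le _ _) z
    _ ≤ ∑ J, sampledNorm (Measure.pi fun _ : Fin n => μ) (copiesKernel n Ω) p Finset.univ
          (fun w => ‖b J w‖ₑ) z := sampledNorm_sum_le hp _ _ (fun J => (hbm J).enorm) z
    _ ≤ ∑ J, mixedNorm (copiesMeasure n μ) p J (a J) := by
        refine Finset.sum_le_sum fun J _ => ?_
        rw [mixedNorm_congr _ p J (hab J), mixedNorm_eq_lmarginal _ p J (b J) z]
        exact (isSampling_copies μ).sampledNorm_univ_le hp (hbm J).enorm J z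

/-- A decomposition into functions with disjoint supports whose norm is at most a constant times
the decoupled integral. -/
theorem exists_isDecomposition (hp : 1 ≤ p)
    (hf : ∀ i, AEStronglyMeasurable (f i) (Measure.pi fun _ => μ))
    (hfin : decoupledIntegral μ p f ≠ ∞) (z : Fin m → Copies n Ω) :
    ∃ a : Finset (Fin m) → (Fin m → Copies n Ω) → 𝕜,
      IsDecomposition (copiesMeasure n μ) p (glue f) a ∧
      (∀ J, mixedNorm (copiesMeasure n μ) p J (a J) ≤
        2 ^ m ^ 2 * 16 ^ (m + 1) * (4 * (2 ^ m * 2 ^ m ^ 2)) * decoupledIntegral μ p f) ∧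
      Pairwise fun J K => Disjoint (support (a J)) (support (a K)) := by
  have hS := isSampling_copies (n := n) μ
  have hglue := aestronglyMeasurable_glue (n := n) μ hf
  set g := hglue.mk (glue f) with hg
  have hgm : Measurable g := hglue.stronglyMeasurable_mk.measurable
  have hD := decoupledIntegral_eq μ p hgm hglue.ae_eq_mk
  have hfin' : ∀ z, sampledNorm (Measure.pi fun _ : Fin n => μ) (copiesKernel n Ω) p Finset.univ
      (fun w => ‖g w‖ₑ) z ≠ ∞ := fun z => by rwa [← hD z]
  set E := maximalSet (Measure.pi fun _ : Fin n => μ) (copiesKernel n Ω) p (fun w => ‖g w‖ₑ) with hE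
  have hEm : ∀ J, MeasurableSet (E J) := measurableSet_maximalSet p hgm.enorm
  have hdisj : Pairwise fun J K => Disjoint (E J) (E K) := pairwise_disjoint_maximalSet p _
  have hnorm : ∀ J, mixedNorm (copiesMeasure n μ) p J ((E J).indicator g) ≤
      2 ^ m ^ 2 * 16 ^ (m + 1) * (4 * (2 ^ m * 2 ^ m ^ 2)) * decoupledIntegral μ p f := fun J => by
    have h := hS.lmarginal_maximalSet_le hp hgm.enorm hfin' J z
    rw [Fintype.card_fin, ← hD z] at h
    rw [mixedNorm_eq_lmarginal _ p J _ z]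
    simpa only [enorm_indicator_eq_indicator_enorm] using h
  refine ⟨fun J => (E J).indicator g, ⟨fun J => ⟨?_, ?_⟩, ?_⟩, hnorm, fun J K hJK => ?_⟩
  · exact (hgm.indicator (hEm J)).aestronglyMeasurable
  · refine (hnorm J).trans_lt ?_
    exact ENNReal.mul_lt_top (by finiteness) hfin.lt_top
  · filter_upwards [hglue.ae_eq_mk, hS.ae_sampledNorm_ne_top hp hgm.enorm hfin'] with w hw hwfin
    rw [hw]
    by_cases h0 : g w = 0
    · refine h0.trans (Finset.sum_eq_zero fun J _ => ?_).symm
      by_cases hJ : w ∈ E J <;> simp [hJ, h0]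
    · obtain ⟨J, hJ⟩ := exists_mem_maximalSet (f := fun w => ‖g w‖ₑ) hp (by simpa using h0) hwfin
      rw [Finset.sum_eq_single J, Set.indicator_of_mem hJ]
      · intro K _ hKJ
        exact Set.indicator_of_notMem (fun hK => Set.disjoint_left.1 (hdisj hKJ) hK hJ) _
      · simp
  · exact (hdisj hJK).mono Set.support_indicator_subset Set.support_indicator_subset

end SumNorm

end DecoupledSum

open DecoupledSum

theorem theorem4p5 (m : ℕ) :
    ∃ C : ℝ≥0, ∀ (𝕜 : Type*) [RCLike 𝕜] (Ω : Type*) [MeasurableSpace Ω] (μ : Measure Ω)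
      [IsProbabilityMeasure μ] (n : ℕ) (p : ℝ) (_ : 1 ≤ p)
      (f : (Fin m → Fin n) → (Fin m → Ω) → 𝕜)
      (_ : ∀ i, Integrable (f i) (Measure.pi fun _ : Fin m => μ))
      (_ : decoupledIntegral μ p f = 1),
      1 ≤ sumNorm (copiesMeasure n μ) p (glue f) ∧
      sumNorm (copiesMeasure n μ) p (glue f) ≤ C ∧
      ∃ a : Finset (Fin m) → (Fin m → Copies n Ω) → 𝕜,
        IsDecomposition (copiesMeasure n μ) p (glue f) a ∧
        ∑ J : Finset (Fin m), mixedNorm (copiesMeasure n μ) p J (a J) ≤ C ∧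
        ∀ i : Fin m → Fin n, Pairwise fun J K : Finset (Fin m) =>
          Disjoint (Function.support (component (a J) i))
            (Function.support (component (a K) i)) := by
  refine ⟨2 ^ m * (2 ^ m ^ 2 * 16 ^ (m + 1) * (4 * (2 ^ m * 2 ^ m ^ 2))),
    fun 𝕜 _ Ω _ μ _ n p hp f hf h1 => ?_⟩
  -- The space is empty only if `n = 0 < m`, when the decoupled integral is `0 ^ (1 / p) = 0`.
  have hz : Nonempty (Fin m → Copies n Ω) := by
    by_contra hempty
    have h0 : decoupledIntegral μ p f = 0 := by
      rw [decoupledIntegral, ← lintegral_zero]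
      refine lintegral_congr fun x => ?_
      have : IsEmpty (Fin m → Fin n) := ⟨fun i => hempty ⟨fun k => (i k, x k (i k))⟩⟩
      rw [Finset.univ_eq_empty, Finset.sum_empty,
        ENNReal.zero_rpow_of_pos (one_div_pos.2 (zero_lt_one.trans_le hp))]
    exact zero_ne_one (h0.symm.trans h1)
  obtain ⟨z⟩ := hz
  obtain ⟨a, ha, hnorm, hdisj⟩ := exists_isDecomposition μ hp (fun i => (hf i).1)
    (by rw [h1]; exact ENNReal.one_ne_top) z
  have hsum : ∑ J, mixedNorm (copiesMeasure n μ) p J (a J) ≤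
      ((2 ^ m * (2 ^ m ^ 2 * 16 ^ (m + 1) * (4 * (2 ^ m * 2 ^ m ^ 2))) : ℝ≥0) : ℝ≥0∞) := by
    refine (Finset.sum_le_sum fun J _ => hnorm J).trans (le_of_eq ?_)
    rw [h1, mul_one, Finset.sum_const, Finset.card_univ, Fintype.card_finset, Fintype.card_fin,
      nsmul_eq_mul]
    push_cast
    rfl
  refine ⟨?_, (iInf₂_le a ha).trans hsum, a, ha, hsum, fun i J K hJK => ?_⟩
  · rw [← h1]
    exact le_iInf₂ fun b hb => decoupledIntegral_le_sum_mixedNorm μ hp hb z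
  · refine Set.disjoint_left.2 ?_
    exact fun x hJ hK => Set.disjoint_left.1 (hdisj hJK) hJ hK
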